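/- **Conventions.** A pregeometry $\Gamma=(X,*,\mathrm{typ})$ over $I$ is a set $X$ with a reflexive symmetric incidence relation $*$ and a type map $\mathrm{typ}:X\to I$ such that incident elements of the same type are equal. A flag is a set of pairwise incident elements, and $\Gamma$ is a geometry if every maximal flag contains an element of each type. The residue of a flag $F$ consists of the elements incident with all elements of $F$ whose types do not occur in $F$. The basic diagram of $\Gamma$ is the graph on $I$ in which $i\neq j$ are adjacent if and only if the residue of some flag of type $I\setminus\{i,j\}$ is not a generalised digon (i.e. contains two non-incident elements of different types). $\Gamma$ has the direct sum property if the residue of each flag is isomorphic to the direct sum of its truncations to the connected components of its diagram (in a direct sum, elements of different summands are incident). $\Gamma$ is simply connected if it is connected and its fundamental group is trivial, that is, every closed path in the incidence graph can be reduced to a trivial path by inserting and deleting returns and triangles. Automorphisms preserve types and incidence. **Hypotheses.** Let $\Gamma=(X,*,\mathrm{typ})$ be a connected geometry over $I=\{1,2,3\}$ with the direct sum property whose basic diagram is the path $1-2-3$. Let $G$ be a group of automorphisms of $\Gamma$ that is transitive on the elements of each type and on the flags of type $\{1,2\}$ and of type $\{2,3\}$. Let $F=\{w^1,w^2,w^3\}$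 be a flag with $w^i$ of type $i$, and let $g\in G_{w^2}$ be such that $w^3$ and $gw^3$ are representatives of the orbits of $G_{w^1,w^2}$ on the elements of type $3$ incident with $w^1$ and $w^2$. Assume moreover that $w^3$ and $gw^3$ lie in different $G_{w^1}$-orbits (so that $G$ has two orbits on the flags of type $\{1,3\}$). **The fused amalgam of parabolics.** $\mathcal A=\mathcal A(\Gamma,G,F)$ consists of the stabilisers in $G$ of the eleven nonempty flags contained in $\{w^1,w^2,w^3,gw^3\}$ (those containing at most one of $w^3$, $gw^3$), with the inclusion maps $G_V\hookrightarrow G_{V'}$ for $V'\subsetneq V$, and with $G_{w^3}$ and $G_{gw^3}$ fused by the isomorphism $\gamma:G_{w^3}\to G_{gw^3}$, $x\mapsto gxg^{-1}$, where $g$ is regarded as an element of the member $G_{w^2}$ of $\mathcal A$. Its universal enveloping group $\mathcal U(\mathcal A)$ is the group generated by symbols $u_x$, one for each element $x$ of the disjoint union of the members of $\mathcal A$, with the following relations: $u_xu_y=u_{xy}$ for $x,y$ in the same member; $u_x=u_{\phi(x)}$ for each inclusion map $\phi$ of $\mathcal A$ and each $x$ in its domain; and $u_{\gamma(x)}=u_g\,u_x\,u_g^{-1}$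 for $x\in G_{w^3}$. **Claim.** The canonical homomorphism $\mathcal U(\mathcal A(\Gamma,G,F))\to G$, $u_x\mapsto x$, is surjective, and $\Gamma$ is simply connected if and only if this homomorphism is an isomorphism. -/

import Mathlib

universe u v

/-- A pregeometry with element set `X` over the type set `I`: a reflexive symmetric incidence
relation and a type function such that incident elements of the same type are equal. -/
structure Pregeometry (X : Type*) (I : Type*) where
  inc : X → X → Prop
  typ : X → I
  inc_refl : ∀ x, inc x x
  inc_symm : ∀ {x y}, inc x y → inc y x
  eq_of_inc : ∀ {x y}, inc x y → typ x = typ y → x = y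

namespace Pregeometry

variable {X : Type*} {I : Type*}

/-- A flag is a set of pairwise incident elements. -/
def IsFlag (Γ : Pregeometry X I) (F : Set X) : Prop :=
  ∀ x ∈ F, ∀ y ∈ F, Γ.inc x y

/-- A geometry is a pregeometry in which every maximal flag contains an element of every type. -/
def IsGeometry (Γ : Pregeometry X I) : Prop :=
  ∀ F : Set X, Maximal Γ.IsFlag F → Γ.typ '' F = Set.univ

/-- The incidence graph. -/
def incidenceGraph (Γ : Pregeometry X I) : SimpleGraph X where
  Adj x y := x ≠ y ∧ Γ.inc x y
  symm := ⟨fun _ _ h => ⟨h.1.symm, Γ.inc_symm h.2⟩⟩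
  loopless := ⟨fun _ h => h.1 rfl⟩

/-- A pregeometry is connected if its incidence graph is. -/
def IsConnected (Γ : Pregeometry X I) : Prop :=
  Γ.incidenceGraph.Connected

/-- The residue of `F`: the elements incident with every element of `F` whose type does not occur
in `F`, as a pregeometry over the remaining types. -/
def residue (Γ : Pregeometry X I) (F : Set X) :
    Pregeometry {x : X // (∀ y ∈ F, Γ.inc x y) ∧ Γ.typ x ∉ Γ.typ '' F}
      {i : I // i ∉ Γ.typ '' F} where
  inc x y := Γ.inc x.1 y.1
  typ x := ⟨Γ.typ x.1, x.2.2⟩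
  inc_refl x := Γ.inc_refl x.1
  inc_symm h := Γ.inc_symm h
  eq_of_inc h ht := Subtype.ext (Γ.eq_of_inc h (congrArg Subtype.val ht))

/-- The truncation to a set `S` of types. -/
def truncation (Γ : Pregeometry X I) (S : Set I) : Pregeometry {x : X // Γ.typ x ∈ S} S where
  inc x y := Γ.inc x.1 y.1
  typ x := ⟨Γ.typ x.1, x.2⟩
  inc_refl x := Γ.inc_refl x.1
  inc_symm h := Γ.inc_symm h
  eq_of_inc h ht := Subtype.ext (Γ.eq_of_inc h (congrArg Subtype.val ht))

/-- The direct sum of a family of pregeometries: the disjoint union, where elements of different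
summands are always incident. -/
def directSum {κ : Type*} {X : κ → Type*} {I : κ → Type*}
    (Γ : ∀ k, Pregeometry (X k) (I k)) : Pregeometry (Σ k, X k) (Σ k, I k) where
  inc p q := ∀ h : p.1 = q.1, (Γ q.1).inc (h ▸ p.2) q.2
  typ p := ⟨p.1, (Γ p.1).typ p.2⟩
  inc_refl p := fun _ => (Γ p.1).inc_refl p.2
  inc_symm {p q} h := by
    obtain ⟨k, x⟩ := p
    obtain ⟨l, y⟩ := q
    intro hkl
    have hkl' : l = k := hkl
    subst hkl'
    exact (Γ l).inc_symm (h rfl)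
  eq_of_inc {p q} h ht := by
    obtain ⟨k, x⟩ := p
    obtain ⟨l, y⟩ := q
    have hkl : k = l := congrArg Sigma.fst ht
    subst hkl
    have ht' := eq_of_heq (Sigma.mk.inj ht).2
    exact congrArg (Sigma.mk k) ((Γ k).eq_of_inc (h rfl) ht')

/-- A rank two pregeometry is a generalised digon if elements of different types are always
incident. -/
def IsGeneralizedDigon (Γ : Pregeometry X I) : Prop :=
  ∀ x y, Γ.typ x ≠ Γ.typ y → Γ.inc x y

/-- The basic diagram: distinct types `i`, `j` are adjacent if and only if the residue of some flag
of type `I \ {i, j}` is not a generalised digon. -/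
def basicDiagram (Γ : Pregeometry X I) : SimpleGraph I where
  Adj i j := i ≠ j ∧ ∃ F : Set X, Γ.IsFlag F ∧ Γ.typ '' F = {i, j}ᶜ ∧
    ¬ (Γ.residue F).IsGeneralizedDigon
  symm := ⟨fun i j h => ⟨h.1.symm, by simpa only [Set.pair_comm j i] using h.2⟩⟩
  loopless := ⟨fun _ h => h.1 rfl⟩

/-- The direct sum of the truncations of `Γ` to the connected components of its diagram. -/
def sumOfComponents (Γ : Pregeometry X I) :=
  directSum fun c : Γ.basicDiagram.ConnectedComponent => Γ.truncation c.supp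

/-- `Γ` is isomorphic, by a bijection that preserves types and incidence, to the direct sum of its
truncations to the connected components of its diagram. (The type set of this sum is the disjoint
union of the components, so `(_).2.1` is the type as an element of `I`.) -/
def IsSumOfComponents (Γ : Pregeometry X I) : Prop :=
  ∃ e : X ≃ Σ c : Γ.basicDiagram.ConnectedComponent, {x : X // Γ.typ x ∈ c.supp},
    (∀ x, (Γ.sumOfComponents.typ (e x)).2.1 = Γ.typ x) ∧
    ∀ x y, Γ.sumOfComponents.inc (e x) (e y) ↔ Γ.inc x y

/-- The direct sum property: every residue of a flag is isomorphic to the direct sum of its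
truncations to the connected components of its diagram. -/
def HasDirectSumProperty (Γ : Pregeometry X I) : Prop :=
  ∀ F : Set X, Γ.IsFlag F → (Γ.residue F).IsSumOfComponents

/-- Homotopy of paths in the incidence graph: the equivalence relation generated by inserting or
deleting a closed path of length at most three, that is a return or a triangle. -/
inductive Homotopic (Γ : Pregeometry X I) :
    ∀ {x y : X}, Γ.incidenceGraph.Walk x y → Γ.incidenceGraph.Walk x y → Prop
  | refl {x y : X} (p : Γ.incidenceGraph.Walk x y) : Homotopic Γ p p
  | symm {x y : X} {p q : Γ.incidenceGraph.Walk x y} : Homotopic Γ p q → Homotopic Γ q p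
  | trans {x y : X} {p q r : Γ.incidenceGraph.Walk x y} :
      Homotopic Γ p q → Homotopic Γ q r → Homotopic Γ p r
  | elementary {x y z : X} (p : Γ.incidenceGraph.Walk x z) (c : Γ.incidenceGraph.Walk z z)
      (q : Γ.incidenceGraph.Walk z y) (hc : c.length ≤ 3) :
      Homotopic Γ (p.append (c.append q)) (p.append q)

/-- A pregeometry is simply connected if it is connected and its fundamental group is trivial:
every closed path is homotopic to the trivial path. -/
def IsSimplyConnected (Γ : Pregeometry X I) : Prop :=
  Γ.IsConnected ∧ ∀ (x : X) (c : Γ.incidenceGraph.Walk x x), Γ.Homotopic c .nil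

/-- The group of (type-preserving) automorphisms, as a group of permutations of the elements. -/
def autGroup (Γ : Pregeometry X I) : Subgroup (Equiv.Perm X) where
  carrier := {σ | (∀ x, Γ.typ (σ x) = Γ.typ x) ∧ ∀ x y, Γ.inc (σ x) (σ y) ↔ Γ.inc x y}
  one_mem' := ⟨fun _ => rfl, fun _ _ => Iff.rfl⟩
  mul_mem' {σ τ} hσ hτ :=
    ⟨fun x => (hσ.1 (τ x)).trans (hτ.1 x), fun x y => (hσ.2 (τ x) (τ y)).trans (hτ.2 x y)⟩
  inv_mem' {σ} hσ :=
    ⟨fun x => by simpa using (hσ.1 (σ⁻¹ x)).symm,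
      fun x y => by simpa using (hσ.2 (σ⁻¹ x) (σ⁻¹ y)).symm⟩

/-- `G` is transitive on the elements of each type. -/
def IsVertexTransitive (Γ : Pregeometry X I) (G : Subgroup (Equiv.Perm X)) : Prop :=
  ∀ x y, Γ.typ x = Γ.typ y → ∃ h ∈ G, h x = y

/-- `G` is transitive on the flags of type `S`. -/
def IsTransitiveOnFlags (Γ : Pregeometry X I) (G : Subgroup (Equiv.Perm X)) (S : Set I) : Prop :=
  ∀ F F' : Set X, Γ.IsFlag F → Γ.IsFlag F' → Γ.typ '' F = S → Γ.typ '' F' = S →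
    ∃ h ∈ G, (fun x => h x) '' F = F'

end Pregeometry

/-- `R` is a set of representatives for the orbits of `H` on `S`. -/
def IsOrbitRepresentatives {G X : Type*} [Group G] [MulAction G X] (H : Subgroup G)
    (S R : Set X) : Prop :=
  R ⊆ S ∧ ∀ y ∈ S, ∃! r, r ∈ R ∧ r ∈ MulAction.orbit H y

/-- An amalgam whose shape is a finite poset `J` graded by `{0, …, m}`, all of whose maximal chains
meet every grade (minimal elements have grade `0`, maximal ones have grade `m`, and a cover raises
the grade by one). -/
structure Amalgam (m : ℕ) (J : Type v) [PartialOrder J] [Finite J]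
    [GradeBoundedOrder (Fin (m + 1)) J] where
  grp : J → Type u
  [group : ∀ j, Group (grp j)]
  map : ∀ {i j : J}, i < j → grp i →* grp j
  map_injective : ∀ {i j : J} (h : i < j), Function.Injective (map h)
  map_map : ∀ {i j k : J} (hij : i < j) (hjk : j < k) (x : grp i),
    map hjk (map hij x) = map (hij.trans hjk) x

attribute [instance] Amalgam.group

/-- A fused amalgam: an amalgam with a fusion. In `fusion_conj`, the element `y` is `g x g⁻¹`,
computed in `grp j₀` and read in `grp i₂`. -/
structure FusedAmalgam (m : ℕ) (J : Type v) [PartialOrder J] [Finite J]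
    [GradeBoundedOrder (Fin (m + 1)) J] extends Amalgam.{u, v} m J where
  j₀ : J
  j₁ : J
  j₂ : J
  grade_j₀ : grade (Fin (m + 1)) j₀ = Fin.last m
  grade_j₁ : grade (Fin (m + 1)) j₁ = Fin.last m
  grade_j₂ : grade (Fin (m + 1)) j₂ = Fin.last m
  g : grp j₀
  i₁ : J
  i₂ : J
  i₁_covBy_j₀ : i₁ ⋖ j₀
  i₁_covBy_j₁ : i₁ ⋖ j₁
  i₂_covBy_j₀ : i₂ ⋖ j₀
  i₂_covBy_j₂ : i₂ ⋖ j₂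
  γ : grp j₁ ≃* grp j₂
  fusion_conj : ∀ x : grp i₁, ∃ y : grp i₂,
    map i₂_covBy_j₀.lt y = g * map i₁_covBy_j₀.lt x * g⁻¹ ∧
    map i₂_covBy_j₂.lt y = γ (map i₁_covBy_j₁.lt x)
  fusion_common : ∀ (i : J) (h₁ : i < j₁) (h₂ : i < j₂) (x : grp i),
    map h₂ x = γ (map h₁ x)

namespace FusedAmalgam

variable {m : ℕ} {J : Type v} [PartialOrder J] [Finite J] [GradeBoundedOrder (Fin (m + 1)) J]

/-- The free generator attached to an element of the disjoint union of the groups of `A`. -/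
def freeGen (A : FusedAmalgam.{u, v} m J) {j : J} (x : A.grp j) : FreeGroup (Σ j, A.grp j) :=
  FreeGroup.of ⟨j, x⟩

/-- The relators of the universal enveloping group: multiplication in each group, identification
along each map of the amalgam, and fusion. -/
def relators (A : FusedAmalgam.{u, v} m J) : Set (FreeGroup (Σ j, A.grp j)) :=
  {r | ∃ (j : J) (x y : A.grp j), r = A.freeGen x * A.freeGen y * (A.freeGen (x * y))⁻¹} ∪
  {r | ∃ (i j : J) (h : i < j) (x : A.grp i), r = A.freeGen x * (A.freeGen (A.map h x))⁻¹} ∪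
  {r | ∃ x : A.grp A.j₁,
    r = A.freeGen (A.γ x) * (A.freeGen A.g * A.freeGen x * (A.freeGen A.g)⁻¹)⁻¹}

/-- The universal enveloping group. -/
abbrev UniversalGroup (A : FusedAmalgam.{u, v} m J) : Type (max u v) :=
  PresentedGroup A.relators

/-- The homomorphism from the universal enveloping group to `H` induced by homomorphisms of the
groups of `A` to `H` that are compatible with the maps of the amalgam and preserve fusion. -/
def lift (A : FusedAmalgam.{u, v} m J) {H : Type*} [Group H] (π : ∀ j, A.grp j →* H)
    (hmap : ∀ (i j : J) (h : i < j) (x : A.grp i), π j (A.map h x) = π i x)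
    (hfus : ∀ x : A.grp A.j₁, π A.j₂ (A.γ x) = π A.j₀ A.g * π A.j₁ x * (π A.j₀ A.g)⁻¹) :
    A.UniversalGroup →* H :=
  PresentedGroup.toGroup (f := fun p : Σ j, A.grp j => π p.1 p.2) (by
    rintro r ((⟨j, x, y, rfl⟩ | ⟨i, j, h, x, rfl⟩) | ⟨x, rfl⟩)
    · simp [freeGen]
    · simp [freeGen, hmap]
    · simp [freeGen, hfus])

end FusedAmalgam

/-- The shape of the amalgam of parabolics with vertices `0, 1, 2, 3`, standing for
`w¹, w², w³, g w³`: the nonempty sets of vertices that do not contain both of the vertices `2, 3`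
(which have the same type), ordered by reverse inclusion. -/
def ParabolicShape : Type :=
  {V : Finset (Fin 4) // V.Nonempty ∧ ¬ (2 ∈ V ∧ 3 ∈ V)}

namespace ParabolicShape

instance : DecidableEq ParabolicShape := inferInstanceAs (DecidableEq (Subtype _))

instance : Fintype ParabolicShape := inferInstanceAs (Fintype (Subtype _))

instance : PartialOrder ParabolicShape :=
  PartialOrder.lift (fun V => OrderDual.toDual V.1) fun _ _ h => Subtype.ext h

instance : DecidableLE ParabolicShape := fun V W => inferInstanceAs (Decidable (W.1 ⊆ V.1))

instance : DecidableLT ParabolicShape := fun V W => inferInstanceAs (Decidable (W.1 ⊂ V.1))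

theorem grade_aux_lt (V : ParabolicShape) : 3 - V.1.card < 3 := by
  have := V.2.1.card_pos
  omega

/-- The grade of a flag of rank `r` is `3 - r`. -/
def gradeFun (V : ParabolicShape) : Fin 3 := ⟨3 - V.1.card, grade_aux_lt V⟩

instance : GradeBoundedOrder (Fin (2 + 1)) ParabolicShape where
  grade := gradeFun
  grade_strictMono := by
    have h : ∀ V W : ParabolicShape, V < W → gradeFun V < gradeFun W := by decide
    exact fun V W => h V W
  covBy_grade {V W} hVW := by
    have h : ∀ V W : ParabolicShape, V < W → (∀ U, V < U → ¬ U < W) →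
        (gradeFun W).1 = (gradeFun V).1 + 1 := by decide
    rw [Fin.covBy_iff]
    exact (Nat.covBy_iff_add_one_eq).2 (h V W hVW.1 fun U => @hVW.2 U).symm
  isMin_grade V hV := by
    have h : ∀ V : ParabolicShape, (∀ U, U ≤ V → V ≤ U) → gradeFun V = 0 := by decide
    rw [h V fun U => @hV U]
    exact isMin_bot
  isMax_grade V hV := by
    have h : ∀ V : ParabolicShape, (∀ U, V ≤ U → U ≤ V) → gradeFun V = Fin.last 2 := by decide
    rw [h V fun U => @hV U]
    exact isMax_top

/-- The vertex `k`. -/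
def vertex (k : Fin 4) : ParabolicShape := ⟨{k}, by revert k; decide⟩

/-- The pair of the vertices `1` and `k`. -/
def pair (k : Fin 4) : ParabolicShape := ⟨{1, k}, by revert k; decide⟩

end ParabolicShape

section Parabolics

variable {G : Type u} {X : Type*} [Group G] [MulAction G X]

/-- The elements `w¹, w², w³, g w³`. -/
def parabolicVertex (w : Fin 3 → X) (g : G) : Fin 4 → X :=
  ![w 0, w 1, w 2, g • w 2]

/-- The parabolic subgroup `G_V`, the stabiliser of all elements of the flag `V`. -/
def parabolic (w : Fin 3 → X) (g : G) (V : ParabolicShape) : Subgroup G :=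
  fixingSubgroup G (parabolicVertex w g '' (V.1 : Set (Fin 4)))

theorem mem_parabolic {w : Fin 3 → X} {g : G} {V : ParabolicShape} {x : G} :
    x ∈ parabolic w g V ↔ ∀ k ∈ V.1, x • parabolicVertex w g k = parabolicVertex w g k := by
  simp [parabolic, mem_fixingSubgroup_iff]

theorem parabolic_mono (w : Fin 3 → X) (g : G) {V W : ParabolicShape} (h : V < W) :
    parabolic w g V ≤ parabolic w g W :=
  fun _ hx => mem_parabolic.2 fun k hk => mem_parabolic.1 hx k (h.le hk)

theorem mem_parabolic_vertex {w : Fin 3 → X} {g x : G} {k : Fin 4} :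
    x ∈ parabolic w g (.vertex k) ↔ x • parabolicVertex w g k = parabolicVertex w g k :=
  mem_parabolic.trans (by simp [ParabolicShape.vertex])

theorem mem_parabolic_pair {w : Fin 3 → X} {g x : G} {k : Fin 4} :
    x ∈ parabolic w g (.pair k) ↔ x • w 1 = w 1 ∧
      x • parabolicVertex w g k = parabolicVertex w g k :=
  mem_parabolic.trans (by simp [ParabolicShape.pair, parabolicVertex])

theorem conj_mem_parabolic_iff (w : Fin 3 → X) (g x : G) :
    g * x * g⁻¹ ∈ parabolic w g (.vertex 3) ↔ x ∈ parabolic w g (.vertex 2) := by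
  simp [mem_parabolic_vertex, parabolicVertex, mul_smul]

/-- Conjugation by `g`, from `G_{w³}` to `G_{g w³}`. -/
def parabolicConj (w : Fin 3 → X) (g : G) :
    parabolic w g (.vertex 2) ≃* parabolic w g (.vertex 3) where
  toFun x := ⟨g * x.1 * g⁻¹, (conj_mem_parabolic_iff w g x.1).2 x.2⟩
  invFun y := ⟨g⁻¹ * y.1 * g, (conj_mem_parabolic_iff w g _).1 (by simp [mul_assoc])⟩
  left_inv x := Subtype.ext (by simp [mul_assoc])
  right_inv y := Subtype.ext (by simp [mul_assoc])
  map_mul' x y := Subtype.ext (by simp [mul_assoc])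

/-- The fused amalgam of parabolics of `G` with respect to the chamber `{w¹, w², w³}` and the
element `g` of `G_{w²}`: the stabilisers of the nonempty flags contained in
`{w¹, w², w³, g w³}`, with inclusions as maps, where `G_{w³}` and `G_{g w³}` are fused by
conjugation with `g`. -/
def parabolicAmalgam (w : Fin 3 → X) (g : G) (hg : g ∈ MulAction.stabilizer G (w 1)) :
    FusedAmalgam.{u, 0} 2 ParabolicShape where
  grp V := parabolic w g V
  map h := Subgroup.inclusion (parabolic_mono w g h)
  map_injective h := Subgroup.inclusion_injective (parabolic_mono w g h)
  map_map _ _ _ := rfl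
  j₀ := .vertex 1
  j₁ := .vertex 2
  j₂ := .vertex 3
  grade_j₀ := rfl
  grade_j₁ := rfl
  grade_j₂ := rfl
  g := ⟨g, mem_parabolic_vertex.2 hg⟩
  i₁ := .pair 2
  i₂ := .pair 3
  i₁_covBy_j₀ := ⟨by decide, by decide⟩
  i₁_covBy_j₁ := ⟨by decide, by decide⟩
  i₂_covBy_j₀ := ⟨by decide, by decide⟩
  i₂_covBy_j₂ := ⟨by decide, by decide⟩
  γ := parabolicConj w g
  fusion_conj x := by
    obtain ⟨h1, h2⟩ := mem_parabolic_pair.1 x.2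
    have hg' : g • w 1 = w 1 := hg
    have hg'' : g⁻¹ • w 1 = w 1 := inv_smul_eq_iff.2 hg'.symm
    have h2' : x.1 • w 2 = w 2 := h2
    refine ⟨⟨g * x.1 * g⁻¹, mem_parabolic_pair.2 ⟨?_, ?_⟩⟩, rfl, rfl⟩
    · rw [mul_smul, mul_smul, hg'', h1, hg']
    · change (g * x.1 * g⁻¹) • g • w 2 = g • w 2
      rw [mul_smul, mul_smul, inv_smul_smul, h2']
  fusion_common i h₁ h₂ :=
    absurd ⟨h₁.le (Finset.mem_singleton_self 2), h₂.le (Finset.mem_singleton_self 3)⟩ i.2.2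

/-- The canonical homomorphism from the universal enveloping group of the fused amalgam of
parabolics to `G`, induced by the inclusions of the parabolics. -/
def parabolicHom (w : Fin 3 → X) (g : G) (hg : g ∈ MulAction.stabilizer G (w 1)) :
    (parabolicAmalgam w g hg).UniversalGroup →* G :=
  (parabolicAmalgam w g hg).lift (fun V => (parabolic w g V).subtype)
    (fun _ _ _ _ => rfl) (fun _ => rfl)

end Parabolics

/-!
The group `G` enters through one property of its action (`IsParabolicSystem`): every flag is a
translate of a set of the vertices `w¹, w², w³, g w³` that contains at most one of `w³, g w³`, and
no element of `G_{w¹}` takes `w³` to `g w³`. In particular every pair and every triple of pairwise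
incident elements is a translate of a flag whose stabiliser is a member of the amalgam, up to the
fusion. Surjectivity of `𝒰 → G`, where `𝒰` is the universal enveloping group, follows by walking
along the incidence graph: the image contains the stabilisers of the vertices and `g`, hence every
element of `G` that takes a vertex to a neighbour of an element already reached.

If `Γ` is simply connected, consider the coset geometry, whose elements of type `i` are the cosets
of `G_{wⁱ}` in `𝒰`. It is connected, since `𝒰` is generated by the parabolics, and its projection
to `Γ` is a covering to which triangles lift (`IsParabolicSystem.isCovering`): uniqueness of lifts
of edges says that two parabolics meet in `𝒰` as they do in `G`. Homotopic paths have lifts with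
the same end, so the projection is injective, and an element of the kernel of `𝒰 → G` fixes the
trivial coset of `G_{w¹}`. It lies in this parabolic, on which the homomorphism is injective.

Conversely, `Γ` is simply connected as soon as every cocycle on its incident pairs, with values in
any group, is a coboundary (`Pregeometry.isSimplyConnected_of_cocycles`); the decisive cocycle comes
from the fundamental groupoid. A cocycle with values in `A` becomes equivariant in the group
`(G → A) ⋊ G`. Twisting the embedding of `G` on each parabolic by the value of an equivariant
cocycle `ε` on the pair of `w¹` and a vertex `vₖ` gives a homomorphism from `𝒰`: the relations of
the amalgam, fusion included, are instances of the cocycle identity. If `𝒰 = G`, this is a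
homomorphism `s` on `G`, and `h vₖ ↦ s(h) ε(w¹, vₖ) h⁻¹` is a potential for `ε`
(`IsParabolicSystem.exists_potential`).
-/

namespace Pregeometry

/-! ### The fundamental groupoid -/

section Homotopy

open CategoryTheory

variable {X : Type u} {I : Type v} {Γ : Pregeometry X I}

theorem Homotopic.append_left {x y z : X} (r : Γ.incidenceGraph.Walk x y)
    {p q : Γ.incidenceGraph.Walk y z} (h : Γ.Homotopic p q) :
    Γ.Homotopic (r.append p) (r.append q) := by
  induction h with
  | refl p => exact .refl _
  | symm _ ih => exact ih.symm
  | trans _ _ ih₁ ih₂ => exact ih₁.trans ih₂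
  | elementary p c q hc =>
    simpa only [SimpleGraph.Walk.append_assoc] using Homotopic.elementary (r.append p) c q hc

theorem Homotopic.append_right {x y z : X} {p q : Γ.incidenceGraph.Walk x y}
    (h : Γ.Homotopic p q) (r : Γ.incidenceGraph.Walk y z) :
    Γ.Homotopic (p.append r) (q.append r) := by
  induction h with
  | refl p => exact .refl _
  | symm _ ih => exact ih.symm
  | trans _ _ ih₁ ih₂ => exact ih₁.trans ih₂
  | elementary p c q hc =>
    simpa only [SimpleGraph.Walk.append_assoc] using Homotopic.elementary p c (q.append r) hc

theorem Homotopic.reverse {x y : X} {p q : Γ.incidenceGraph.Walk x y}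
    (h : Γ.Homotopic p q) : Γ.Homotopic p.reverse q.reverse := by
  induction h with
  | refl p => exact .refl _
  | symm _ ih => exact ih.symm
  | trans _ _ ih₁ ih₂ => exact ih₁.trans ih₂
  | elementary p c q hc =>
    simpa only [SimpleGraph.Walk.reverse_append, SimpleGraph.Walk.append_assoc] using
      Homotopic.elementary q.reverse c.reverse p.reverse (by simpa using hc)

theorem homotopic_nil_of_length_le {x : X} (c : Γ.incidenceGraph.Walk x x) (hc : c.length ≤ 3) :
    Γ.Homotopic c .nil := by
  simpa using Homotopic.elementary .nil c .nil hc

theorem homotopic_append_reverse {x y : X} (p : Γ.incidenceGraph.Walk x y) :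
    Γ.Homotopic (p.append p.reverse) .nil := by
  induction p with
  | nil => exact .refl _
  | cons h p ih =>
    -- Cancel inside the first and the last edge, then cancel the remaining return.
    have h₁ := (ih.append_right (.cons h.symm .nil)).append_left (.cons h .nil)
    have h₂ := homotopic_nil_of_length_le (Γ := Γ) (.cons h (.cons h.symm .nil)) (by simp)
    refine Homotopic.trans ?_ h₂
    simpa [SimpleGraph.Walk.reverse_cons, SimpleGraph.Walk.append_assoc] using h₁

theorem homotopic_reverse_append {x y : X} (p : Γ.incidenceGraph.Walk x y) :
    Γ.Homotopic (p.reverse.append p) .nil := by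
  simpa using homotopic_append_reverse p.reverse

/-- Homotopy of paths as an equivalence relation. -/
def homotopySetoid (Γ : Pregeometry X I) (x y : X) : Setoid (Γ.incidenceGraph.Walk x y) where
  r := Γ.Homotopic
  iseqv := ⟨.refl, .symm, .trans⟩

/-- The fundamental groupoid: its objects are the elements of `Γ`, its morphisms the homotopy
classes of paths. -/
def FundamentalGroupoid (_ : Pregeometry X I) : Type u := X

instance : Groupoid Γ.FundamentalGroupoid where
  Hom x y := Quotient (Γ.homotopySetoid x y)
  id x := Quotient.mk (Γ.homotopySetoid x x) .nil
  comp {x y z} := Quotient.map₂ (sc := Γ.homotopySetoid x z) (fun p q => p.append q)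
    fun _ p' hp q _ hq => Homotopic.trans (Homotopic.append_right hp q)
      (Homotopic.append_left p' hq)
  inv {x y} := Quotient.map (sb := Γ.homotopySetoid y x) (fun p => p.reverse)
    fun _ _ hp => Homotopic.reverse hp
  id_comp p := by
    induction p using Quotient.ind
    rfl
  comp_id {x y} p := by
    induction p using Quotient.ind with
    | _ p => exact congrArg (Quotient.mk (Γ.homotopySetoid x y)) p.append_nil
  assoc {x y z t} p q r := by
    induction p using Quotient.ind with
    | _ p =>
      induction q using Quotient.ind with
      | _ q =>
        induction r using Quotient.ind with
        | _ r => exact congrArg (Quotient.mk (Γ.homotopySetoid x t)) (p.append_assoc q r).symm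
  comp_inv {x y} p := by
    induction p using Quotient.ind with
    | _ p => exact Quotient.sound (s := Γ.homotopySetoid x x) (homotopic_append_reverse p)
  inv_comp {x y} p := by
    induction p using Quotient.ind with
    | _ p =>
      exact Quotient.sound (s := Γ.homotopySetoid y y) (homotopic_reverse_append p)

/-- An element of `Γ` as an object of the fundamental groupoid. -/
def obj (Γ : Pregeometry X I) (x : X) : Γ.FundamentalGroupoid := x

/-- The homotopy class of a path. -/
def homotopyClass {x y : X} (p : Γ.incidenceGraph.Walk x y) : Γ.obj x ⟶ Γ.obj y :=
  Quotient.mk (Γ.homotopySetoid x y) p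

theorem homotopyClass_eq_iff {x y : X} {p q : Γ.incidenceGraph.Walk x y} :
    homotopyClass p = homotopyClass q ↔ Γ.Homotopic p q :=
  Quotient.eq (r := Γ.homotopySetoid x y)

theorem homotopyClass_cons {x y z : X} (h : Γ.incidenceGraph.Adj x y)
    (p : Γ.incidenceGraph.Walk y z) :
    homotopyClass (.cons h p) = homotopyClass (.cons h .nil) ≫ homotopyClass p :=
  rfl

open scoped Classical in
/-- The class of the path of length at most one between two incident elements. -/
noncomputable def edgeClass {x y : X} (h : Γ.inc x y) : Γ.obj x ⟶ Γ.obj y :=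
  if hxy : x = y then eqToHom (congrArg Γ.obj hxy) else homotopyClass (.cons ⟨hxy, h⟩ .nil)

theorem edgeClass_of_adj {x y : X} (h : Γ.incidenceGraph.Adj x y) :
    edgeClass h.2 = homotopyClass (.cons h .nil) :=
  dif_neg h.1

theorem edgeClass_self (x : X) : edgeClass (Γ.inc_refl x) = 𝟙 (Γ.obj x) := by
  simp [edgeClass]

theorem edgeClass_comp {x y z : X} (hxy : Γ.inc x y) (hyz : Γ.inc y z) (hxz : Γ.inc x z) :
    edgeClass hxy ≫ edgeClass hyz = edgeClass hxz := by
  by_cases h₁ : x = y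
  · subst h₁
    simp [edgeClass_self]
  by_cases h₂ : y = z
  · subst h₂
    simp [edgeClass_self]
  have h₁' : Γ.incidenceGraph.Adj x y := ⟨h₁, hxy⟩
  have h₂' : Γ.incidenceGraph.Adj y z := ⟨h₂, hyz⟩
  rw [edgeClass_of_adj h₁', edgeClass_of_adj h₂']
  by_cases h₃ : x = z
  · subst h₃
    rw [edgeClass_self]
    exact homotopyClass_eq_iff.2
      (homotopic_nil_of_length_le (.cons h₁' (.cons h₂' .nil)) (by simp))
  · have h₃' : Γ.incidenceGraph.Adj x z := ⟨h₃, hxz⟩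
    rw [edgeClass_of_adj h₃', ← homotopyClass_cons, homotopyClass_eq_iff]
    -- The path `x, y, z` is homotopic to the path `x, y, z, x, z`, and this one to `x, z`.
    have h₄ := Homotopic.elementary (Γ := Γ) (.cons h₁' (.cons h₂' .nil))
      (.cons h₃'.symm (.cons h₃' .nil)) .nil (by simp)
    have h₅ := Homotopic.elementary (Γ := Γ) .nil
      (.cons h₁' (.cons h₂' (.cons h₃'.symm .nil))) (.cons h₃' .nil) (by simp)
    exact h₄.symm.trans h₅

/-- A connected pregeometry is simply connected if every multiplicative cocycle on it, that is,
every labelling of the incident pairs by elements of a group that multiplies along triangles, is a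
coboundary. The cocycle that detects closed paths takes its values in a vertex group of the
fundamental groupoid. -/
theorem isSimplyConnected_of_cocycles (hconn : Γ.IsConnected)
    (H : ∀ (A : Type u) [Group A] (c : X → X → A),
      (∀ x y z, Γ.inc x y → Γ.inc y z → Γ.inc x z → c x y * c y z = c x z) →
      ∃ f : X → A, ∀ x y, Γ.inc x y → c x y = (f x)⁻¹ * f y) : Γ.IsSimplyConnected := by
  classical
  refine ⟨hconn, fun x₀ p₀ => ?_⟩
  let P (x : X) : Γ.obj x₀ ⟶ Γ.obj x := homotopyClass (hconn.preconnected x₀ x).some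
  let c (x y : X) : Γ.obj x₀ ⟶ Γ.obj x₀ :=
    if h : Γ.inc x y then P x ≫ edgeClass h ≫ inv (P y) else 𝟙 _
  obtain ⟨f, hf⟩ := H (Γ.obj x₀ ⟶ Γ.obj x₀) c fun x y z hxy hyz hxz => by
    simp only [c, dif_pos hxy, dif_pos hyz, dif_pos hxz, Groupoid.vertexGroup_mul,
      ← edgeClass_comp hxy hyz hxz]
    simp
  have key : ∀ {x y : X} (p : Γ.incidenceGraph.Walk x y),
      P x ≫ homotopyClass p ≫ inv (P y) = (f x)⁻¹ * f y := by
    intro x y p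
    induction p with
    | @nil x =>
      rw [inv_mul_cancel]
      exact (congrArg (P x ≫ ·) (Category.id_comp (inv (P x)))).trans (IsIso.hom_inv_id (P x))
    | @cons x y z h p ih =>
      have := hf _ _ h.2
      simp only [c, dif_pos h.2, edgeClass_of_adj h] at this
      rw [homotopyClass_cons, ← mul_inv_cancel_left (f y) (f z), ← mul_assoc, ← ih, ← this,
        Groupoid.vertexGroup_mul]
      simp
  have h := key p₀
  rw [inv_mul_cancel] at h
  have h' : P x₀ ≫ homotopyClass p₀ ≫ inv (P x₀) = 𝟙 _ := h
  rw [← Category.assoc, IsIso.comp_inv_eq, Category.id_comp] at h'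
  refine homotopyClass_eq_iff.1 ((cancel_epi (P x₀)).1 ?_)
  rw [h']
  exact (Category.comp_id _).symm

end Homotopy

/-! ### Lifting paths along a covering -/

section Covering

variable {X Y I : Type*} {Γ : Pregeometry X I}

/-- The map `p` is a covering of the incidence graph of `Γ` by the graph `R`, such that triangles
lift to triangles. -/
structure IsCovering (Γ : Pregeometry X I) (p : Y → X) (R : Y → Y → Prop) : Prop where
  symm : ∀ {a b}, R a b → R b a
  adj : ∀ {a b}, R a b → Γ.incidenceGraph.Adj (p a) (p b)
  exists_lift : ∀ {a y}, Γ.incidenceGraph.Adj (p a) y → ∃ b, R a b ∧ p b = y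
  unique : ∀ {a b b'}, R a b → R a b' → p b = p b' → b = b'
  triangle : ∀ {a b c}, R a b → R b c → Γ.incidenceGraph.Adj (p a) (p c) → R a c

namespace IsCovering

variable {p : Y → X} {R : Y → Y → Prop}

open scoped Classical in
/-- The `R`-neighbour of `a` above `y` (or `a`, if there is none). -/
noncomputable def step (p : Y → X) (R : Y → Y → Prop) (a : Y) (y : X) : Y :=
  if h : ∃ b, R a b ∧ p b = y then h.choose else a

theorem step_eq (hp : Γ.IsCovering p R) {a b : Y} (h : R a b) : step p R a (p b) = b := by
  have hex : ∃ b', R a b' ∧ p b' = p b := ⟨b, h, rfl⟩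
  rw [step, dif_pos hex]
  exact hp.unique hex.choose_spec.1 h hex.choose_spec.2

theorem step_spec (hp : Γ.IsCovering p R) {a : Y} {y : X} (h : Γ.incidenceGraph.Adj (p a) y) :
    R a (step p R a y) ∧ p (step p R a y) = y := by
  have hex := hp.exists_lift h
  rw [step, dif_pos hex]
  exact hex.choose_spec

/-- The end point of the lift of a path that starts at `a`. -/
noncomputable def lift (p : Y → X) (R : Y → Y → Prop) :
    ∀ {x y : X}, Γ.incidenceGraph.Walk x y → Y → Y
  | _, _, .nil, a => a
  | _, _, .cons (v := z) _ q, a => lift p R q (step p R a z)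

theorem lift_append {x y z : X} (q : Γ.incidenceGraph.Walk x y) (r : Γ.incidenceGraph.Walk y z)
    (a : Y) : lift p R (q.append r) a = lift p R r (lift p R q a) := by
  induction q generalizing a with
  | nil => rfl
  | cons h q ih => exact ih r _

theorem proj_lift (hp : Γ.IsCovering p R) {x y : X} (q : Γ.incidenceGraph.Walk x y) {a : Y}
    (ha : p a = x) : p (lift p R q a) = y := by
  induction q generalizing a with
  | nil => exact ha
  | cons h q ih =>
    subst ha
    exact ih (hp.step_spec h).2

theorem lift_of_length_le (hp : Γ.IsCovering p R) {x : X} (c : Γ.incidenceGraph.Walk x x)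
    (hc : c.length ≤ 3) {a : Y} (ha : p a = x) : lift p R c a = a := by
  subst ha
  match c, hc with
  | .nil, _ => rfl
  | .cons h .nil, _ => exact absurd rfl h.1
  | .cons h₁ (.cons h₂ .nil), _ =>
    exact hp.step_eq (hp.symm (hp.step_spec h₁).1)
  | .cons (v := y) h₁ (.cons (v := z) h₂ (.cons h₃ .nil)), _ =>
    obtain ⟨hb, hy⟩ := hp.step_spec h₁
    rw [← hy] at h₂
    obtain ⟨hc, hz⟩ := hp.step_spec h₂
    refine hp.step_eq (hp.symm (hp.triangle hb hc ?_))
    rw [hz]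
    exact h₃.symm

theorem lift_eq_of_homotopic (hp : Γ.IsCovering p R) {x y : X}
    {q r : Γ.incidenceGraph.Walk x y} (h : Γ.Homotopic q r) {a : Y} (ha : p a = x) :
    lift p R q a = lift p R r a := by
  induction h with
  | refl => rfl
  | symm _ ih => exact ih.symm
  | trans _ _ ih₁ ih₂ => exact ih₁.trans ih₂
  | elementary q c r hc =>
    rw [lift_append, lift_append, lift_append, hp.lift_of_length_le c hc (hp.proj_lift q ha)]

theorem exists_walk_lift_eq (hp : Γ.IsCovering p R) {a b : Y} (h : Relation.ReflTransGen R a b) :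
    ∃ q : Γ.incidenceGraph.Walk (p a) (p b), lift p R q a = b := by
  induction h using Relation.ReflTransGen.head_induction_on with
  | refl => exact ⟨.nil, rfl⟩
  | head h _ ih =>
    obtain ⟨q, hq⟩ := ih
    refine ⟨.cons (hp.adj h) q, ?_⟩
    rw [lift, hp.step_eq h, hq]

/-- A connected covering of a simply connected pregeometry is injective. -/
theorem eq_of_proj_eq (hp : Γ.IsCovering p R) (hΓ : Γ.IsSimplyConnected) {a b : Y}
    (h : Relation.ReflTransGen R a b) (hab : p a = p b) : a = b := by
  obtain ⟨q, hq⟩ := hp.exists_walk_lift_eq h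
  rw [← hq]
  have : ∀ {y : X} (q : Γ.incidenceGraph.Walk (p a) y), p a = y → lift p R q a = a := by
    rintro y q rfl
    exact hp.lift_eq_of_homotopic (hΓ.2 _ q) rfl
  exact (this q hab).symm

end IsCovering

end Covering

end Pregeometry

/-! ### The universal enveloping group -/

namespace FusedAmalgam

variable {m : ℕ} {J : Type v} [PartialOrder J] [Finite J] [GradeBoundedOrder (Fin (m + 1)) J]
  (A : FusedAmalgam.{u, v} m J)

/-- The canonical homomorphism from a group of the amalgam to the universal enveloping group. -/
def incl (j : J) : A.grp j →* A.UniversalGroup :=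
  MonoidHom.mk' (fun x => PresentedGroup.of ⟨j, x⟩) fun x y =>
    (PresentedGroup.mk_eq_mk_of_mul_inv_mem (Or.inl (Or.inl ⟨j, x, y, rfl⟩))).symm

theorem incl_map {i j : J} (h : i < j) (x : A.grp i) : A.incl j (A.map h x) = A.incl i x :=
  (PresentedGroup.mk_eq_mk_of_mul_inv_mem (Or.inl (Or.inr ⟨i, j, h, x, rfl⟩))).symm

theorem incl_γ (x : A.grp A.j₁) :
    A.incl A.j₂ (A.γ x) = A.incl A.j₀ A.g * A.incl A.j₁ x * (A.incl A.j₀ A.g)⁻¹ :=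
  PresentedGroup.mk_eq_mk_of_mul_inv_mem (Or.inr ⟨x, rfl⟩)

theorem lift_incl {H : Type*} [Group H] (π : ∀ j, A.grp j →* H)
    (hmap : ∀ (i j : J) (h : i < j) (x : A.grp i), π j (A.map h x) = π i x)
    (hfus : ∀ x : A.grp A.j₁, π A.j₂ (A.γ x) = π A.j₀ A.g * π A.j₁ x * (π A.j₀ A.g)⁻¹)
    {j : J} (x : A.grp j) : A.lift π hmap hfus (A.incl j x) = π j x :=
  PresentedGroup.toGroup.of _

theorem mem_of_incl_mem (H : Subgroup A.UniversalGroup) (h : ∀ j x, A.incl j x ∈ H)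
    (u : A.UniversalGroup) : u ∈ H :=
  PresentedGroup.generated_by A.relators H (fun p => h p.1 p.2) u

theorem hom_ext {H : Type*} [Group H] {f f' : A.UniversalGroup →* H}
    (h : ∀ j x, f (A.incl j x) = f' (A.incl j x)) : f = f' :=
  PresentedGroup.ext fun p => h p.1 p.2

end FusedAmalgam

/-! ### Parabolic systems -/

/-- The type of the element `parabolicVertex w g k`. -/
def vertexType : Fin 4 → Fin 3 := ![0, 1, 2, 2]

theorem vertexType_eq_iff {k l : Fin 4} :
    vertexType k = vertexType l ↔ k = l ∨ (k = 2 ∧ l = 3) ∨ (k = 3 ∧ l = 2) := by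
  revert k l
  decide

/-- What the hypotheses on `Γ` and `G` amount to: `G` acts by automorphisms, every flag is the
translate of a set of the vertices `w¹, w², w³, g w³` that does not contain both of `w³, g w³`
(such sets are flags), and no element of `G_{w¹}` takes `w³` to `g w³`. -/
structure IsParabolicSystem {G : Type u} {X : Type v} [Group G] [MulAction G X]
    (Γ : Pregeometry X (Fin 3)) (w : Fin 3 → X) (g : G) : Prop where
  typ_smul : ∀ (h : G) (x : X), Γ.typ (h • x) = Γ.typ x
  inc_smul_iff : ∀ (h : G) (x y : X), Γ.inc (h • x) (h • y) ↔ Γ.inc x y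
  typ_vertex : ∀ k, Γ.typ (parabolicVertex w g k) = vertexType k
  inc_vertex : ∀ (V : ParabolicShape) (k l : Fin 4), k ∈ V.1 → l ∈ V.1 →
    Γ.inc (parabolicVertex w g k) (parabolicVertex w g l)
  exists_smul_vertex : ∀ F : Set X, Γ.IsFlag F → ∃ (h : G) (V : ParabolicShape),
    ∀ x ∈ F, ∃ k ∈ V.1, x = h • parabolicVertex w g k
  separated : ∀ h : G, h • w 0 = w 0 → h • w 2 ≠ g • w 2

/-- A flag contained in a geometry extends to one with an element of every type. -/
theorem Pregeometry.IsGeometry.exists_flag_superset {X I : Type*} {Γ : Pregeometry X I}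
    (hΓ : Γ.IsGeometry) {F : Set X} (hF : Γ.IsFlag F) :
    ∃ F', F ⊆ F' ∧ Γ.IsFlag F' ∧ Γ.typ '' F' = Set.univ := by
  obtain ⟨F', hFF', hF'⟩ := zorn_subset_nonempty {F | Γ.IsFlag F} (by
    intro c hc hchain _
    refine ⟨⋃₀ c, ?_, fun s hs => Set.subset_sUnion_of_mem hs⟩
    rintro x ⟨s, hs, hxs⟩ y ⟨t, ht, hyt⟩
    obtain hst | hts := hchain.total hs ht
    · exact hc ht x (hst hxs) y hyt
    · exact hc hs x hxs y (hts hyt)) F hF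
  exact ⟨F', hFF', hF'.1, hΓ F' hF'⟩

/-- Transitivity on the flags of type `{1, 2}` and the orbits of `G_{w¹, w²}` on the elements of
type `3` give two orbits of `G` on maximal flags, with representatives `{w¹, w², w³}` and
`{w¹, w², g w³}`; every flag is contained in a maximal one. (The types `1, 2, 3` are `0, 1, 2` in
`Fin 3`.) -/
theorem isParabolicSystem_of_isTransitiveOnFlags {X : Type*} {Γ : Pregeometry X (Fin 3)}
    (hgeom : Γ.IsGeometry) {G : Subgroup (Equiv.Perm X)} (hG : G ≤ Γ.autGroup)
    (hflag : Γ.IsTransitiveOnFlags G {0, 1})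
    {w : Fin 3 → X} (hw : ∀ i, Γ.typ (w i) = i) (hF : Γ.IsFlag (Set.range w))
    {g : G}
    (horb : IsOrbitRepresentatives
      (MulAction.stabilizer G (w 0) ⊓ MulAction.stabilizer G (w 1))
      {y | Γ.typ y = 2 ∧ Γ.inc y (w 0) ∧ Γ.inc y (w 1)} {w 2, g • w 2})
    (hsep : g • w 2 ∉ MulAction.orbit (MulAction.stabilizer G (w 0)) (w 2)) :
    IsParabolicSystem Γ w g := by
  have hinc : ∀ i j, Γ.inc (w i) (w j) := fun i j => hF _ ⟨i, rfl⟩ _ ⟨j, rfl⟩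
  have htyp : ∀ (h : G) (x : X), Γ.typ (h • x) = Γ.typ x := fun h => (hG h.2).1
  have hincsmul : ∀ (h : G) (x y : X), Γ.inc (h • x) (h • y) ↔ Γ.inc x y := fun h => (hG h.2).2
  have hgw := horb.1 (Set.mem_insert_of_mem _ rfl)
  refine ⟨htyp, hincsmul, ?_, ?_, ?_, ?_⟩
  · intro k
    fin_cases k
    · exact hw 0
    · exact hw 1
    · exact hw 2
    · exact hgw.1
  · have h : ∀ k l : Fin 4, ¬ (k = 2 ∧ l = 3) → ¬ (k = 3 ∧ l = 2) →
        Γ.inc (parabolicVertex w g k) (parabolicVertex w g l) := by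
      intro k l
      fin_cases k <;> fin_cases l <;> intro h₁ h₂
      all_goals first
        | exact absurd ⟨rfl, rfl⟩ h₁
        | exact absurd ⟨rfl, rfl⟩ h₂
        | exact hinc _ _
        | exact hgw.2.1
        | exact hgw.2.2
        | exact Γ.inc_symm hgw.2.1
        | exact Γ.inc_symm hgw.2.2
        | exact Γ.inc_refl _
    intro V k l hk hl
    refine h k l ?_ ?_
    · rintro ⟨rfl, rfl⟩
      exact V.2.2 ⟨hk, hl⟩
    · rintro ⟨rfl, rfl⟩
      exact V.2.2 ⟨hl, hk⟩
  · intro F hFlag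
    obtain ⟨F', hFF', hF', htypes⟩ := hgeom.exists_flag_superset hFlag
    have hex : ∀ i, ∃ x ∈ F', Γ.typ x = i := fun i => by
      simpa using htypes.ge (Set.mem_univ i)
    choose z hzF hz using hex
    have hzuniq : ∀ x ∈ F', x = z (Γ.typ x) := fun x hx =>
      Γ.eq_of_inc (hF' x hx _ (hzF _)) (hz _).symm
    have hsubw : {w 0, w 1} ⊆ Set.range w := by
      rintro _ (rfl | rfl) <;> exact ⟨_, rfl⟩
    have hsubz : {z 0, z 1} ⊆ F' := by
      rintro _ (rfl | rfl) <;> exact hzF _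
    -- First move `{w¹, w²}` to the elements of the first two types, then use the orbits on the
    -- elements of the third type.
    obtain ⟨h, hhG, hh⟩ := hflag {w 0, w 1} {z 0, z 1}
      (fun x hx y hy => hF x (hsubw hx) y (hsubw hy))
      (fun x hx y hy => hF' x (hsubz hx) y (hsubz hy))
      (by simp [Set.image_pair, hw]) (by simp [Set.image_pair, hz])
    have hmem : ∀ i, i = 0 ∨ i = 1 → h (w i) = z i := by
      intro i hi
      have h₁ : h (w i) ∈ ({z 0, z 1} : Set X) := by
        rw [← hh]
        exact ⟨w i, hi.imp (congrArg w) (congrArg w), rfl⟩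
      have h₂ : h (w i) ∈ F' := hsubz h₁
      have h₃ : Γ.typ (h (w i)) = i := ((hG hhG).1 _).trans (hw i)
      rw [hzuniq _ h₂, h₃]
    let h' : G := ⟨h, hhG⟩
    have h0 : h' • w 0 = z 0 := hmem 0 (Or.inl rfl)
    have h1 : h' • w 1 = z 1 := hmem 1 (Or.inr rfl)
    have h2 : h'⁻¹ • z 2 ∈ {y | Γ.typ y = 2 ∧ Γ.inc y (w 0) ∧ Γ.inc y (w 1)} := by
      refine ⟨(htyp _ _).trans (hz 2), ?_, ?_⟩
      · rw [← hincsmul h', smul_inv_smul, h0]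
        exact hF' _ (hzF _) _ (hzF _)
      · rw [← hincsmul h', smul_inv_smul, h1]
        exact hF' _ (hzF _) _ (hzF _)
    obtain ⟨r, ⟨hr, ⟨⟨k, hk0, hk1⟩, hk⟩⟩, _⟩ := horb.2 _ h2
    have hk0' : k⁻¹ • w 0 = w 0 := inv_smul_eq_iff.2 hk0.symm
    have hk1' : k⁻¹ • w 1 = w 1 := inv_smul_eq_iff.2 hk1.symm
    have hk2 : (h' * k⁻¹) • r = z 2 := by
      rw [mul_smul, ← hk]
      change h' • k⁻¹ • k • h'⁻¹ • z 2 = z 2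
      rw [inv_smul_smul, smul_inv_smul]
    have main : ∀ l : Fin 4, parabolicVertex w g l = r → ∀ V : ParabolicShape,
        0 ∈ V.1 → 1 ∈ V.1 → l ∈ V.1 →
        ∀ x ∈ F, ∃ k' ∈ V.1, x = (h' * k⁻¹) • parabolicVertex w g k' := by
      intro l hl V hV0 hV1 hVl x hx
      have key : ∀ i, ∃ k' ∈ V.1, z i = (h' * k⁻¹) • parabolicVertex w g k' := by
        intro i
        fin_cases i
        · exact ⟨0, hV0, by rw [mul_smul]; exact (h0.symm.trans (congrArg _ hk0'.symm))⟩
        · exact ⟨1, hV1, by rw [mul_smul]; exact (h1.symm.trans (congrArg _ hk1'.symm))⟩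
        · exact ⟨l, hVl, by rw [hl]; exact hk2.symm⟩
      obtain ⟨k', hk', hzk⟩ := key (Γ.typ x)
      exact ⟨k', hk', (hzuniq x (hFF' hx)).trans hzk⟩
    obtain rfl | rfl := hr
    · exact ⟨_, ⟨{0, 1, 2}, by decide⟩, main 2 rfl _ (by decide) (by decide) (by decide)⟩
    · exact ⟨_, ⟨{0, 1, 3}, by decide⟩, main 3 rfl _ (by decide) (by decide) (by decide)⟩
  · exact fun h h0 h2 => hsep ⟨⟨h, h0⟩, h2⟩

section ParabolicIncl

variable {G : Type u} {X : Type v} [Group G] [MulAction G X] (w : Fin 3 → X) (g : G)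
  (hg : g ∈ MulAction.stabilizer G (w 1))

/-- The canonical homomorphism from a parabolic subgroup to the universal enveloping group. -/
def parabolicIncl (V : ParabolicShape) :
    parabolic w g V →* (parabolicAmalgam w g hg).UniversalGroup :=
  (parabolicAmalgam w g hg).incl V

theorem parabolicHom_incl (V : ParabolicShape) (x : parabolic w g V) :
    parabolicHom w g hg (parabolicIncl w g hg V x) = x :=
  (parabolicAmalgam w g hg).lift_incl _ _ _ x

variable {w g} in
theorem parabolicHom_surjective_of_isConnected {Γ : Pregeometry X (Fin 3)}
    (S : IsParabolicSystem Γ w g) (hconn : Γ.IsConnected) :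
    Function.Surjective (parabolicHom w g hg) := by
  set H := (parabolicHom w g hg).range
  have hstab : ∀ (k : Fin 4) (x : G), x • parabolicVertex w g k = parabolicVertex w g k → x ∈ H :=
    fun k x hx => ⟨parabolicIncl w g hg (.vertex k) ⟨x, mem_parabolic_vertex.2 hx⟩,
      parabolicHom_incl w g hg _ _⟩
  have hgH : g ∈ H := hstab 1 g hg
  have hsame : ∀ (k l : Fin 4) (x : G), vertexType k = vertexType l →
      x • parabolicVertex w g k = parabolicVertex w g l → x ∈ H := by
    intro k l x hkl hx
    obtain rfl | ⟨rfl, rfl⟩ | ⟨rfl, rfl⟩ := vertexType_eq_iff.1 hkl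
    · exact hstab _ x hx
    · have h' : g⁻¹ * x ∈ H := hstab 2 _ (by rw [mul_smul, hx]; exact inv_smul_smul g (w 2))
      simpa using H.mul_mem hgH h'
    · have h' : x * g ∈ H := hstab 2 _ (by rw [mul_smul]; exact hx)
      simpa using H.mul_mem h' (H.inv_mem hgH)
  -- The set of elements `y` such that every translation of a vertex to `y` lies in the range is
  -- closed under incidence.
  have hstep : ∀ y z, Γ.inc y z →
      (∀ (k : Fin 4) (x : G), x • parabolicVertex w g k = y → x ∈ H) →
      ∀ (k : Fin 4) (x : G), x • parabolicVertex w g k = z → x ∈ H := by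
    intro y z hyz hy l x hx
    obtain ⟨h, V, hV⟩ := S.exists_smul_vertex {y, z} (by
      rintro _ (rfl | rfl) _ (rfl | rfl)
      exacts [Γ.inc_refl _, hyz, Γ.inc_symm hyz, Γ.inc_refl _])
    obtain ⟨k, -, hk⟩ := hV y (Or.inl rfl)
    obtain ⟨l', -, hl'⟩ := hV z (Or.inr rfl)
    have hmove : h⁻¹ * x ∈ H := by
      refine hsame l l' _ ?_ (by rw [mul_smul, hx, hl', inv_smul_smul])
      rw [← S.typ_vertex, ← S.typ_vertex, ← S.typ_smul x, hx, hl', S.typ_smul]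
    simpa using H.mul_mem (hy k h hk.symm) hmove
  have hall : ∀ y, ∀ (k : Fin 4) (x : G), x • parabolicVertex w g k = y → x ∈ H := by
    intro y
    obtain ⟨p⟩ := hconn.preconnected (w 0) y
    have hbase : ∀ (k : Fin 4) (x : G), x • parabolicVertex w g k = w 0 → x ∈ H := by
      intro k x hx
      refine hsame k 0 x ?_ hx
      rw [← S.typ_vertex, ← S.typ_vertex, ← S.typ_smul x, hx]
      rfl
    generalize w 0 = x₀ at p hbase
    induction p with
    | nil => exact hbase
    | cons h p ih => exact ih (hstep _ _ h.2 hbase)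
  exact fun x => hall _ 0 x rfl

end ParabolicIncl

/-! ### Cocycles -/

section Cocycle

variable {G : Type u} {X : Type v} [Group G] [MulAction G X] {Γ : Pregeometry X (Fin 3)}
  {w : Fin 3 → X} {g : G}

theorem IsParabolicSystem.inc_vertex_zero (S : IsParabolicSystem Γ w g) (k : Fin 4) :
    Γ.inc (w 0) (parabolicVertex w g k) := by
  have h : ∀ k : Fin 4, ∃ V : ParabolicShape, 0 ∈ V.1 ∧ k ∈ V.1 := by decide
  obtain ⟨V, h0, hk⟩ := h k
  exact S.inc_vertex V 0 k h0 hk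

theorem IsParabolicSystem.inc_vertex_one (S : IsParabolicSystem Γ w g) (k : Fin 4) :
    Γ.inc (parabolicVertex w g 1) (parabolicVertex w g k) := by
  have h : ∀ k : Fin 4, ∃ V : ParabolicShape, 1 ∈ V.1 ∧ k ∈ V.1 := by decide
  obtain ⟨V, h1, hk⟩ := h k
  exact S.inc_vertex V 1 k h1 hk

variable {W : Type*} [Group W] {ε : X → X → W} {ι : G →* W}

/-- If a cocycle `ε` is equivariant for conjugation by `ι`, then twisting `ι` on each parabolic by
the value of `ε` on the pair of `w¹` and a vertex fixed by the parabolic gives a homomorphism from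
the universal enveloping group. -/
theorem IsParabolicSystem.exists_twisted_hom (S : IsParabolicSystem Γ w g)
    (hg : g ∈ MulAction.stabilizer G (w 1))
    (hε : ∀ x y z, Γ.inc x y → Γ.inc y z → Γ.inc x z → ε x y * ε y z = ε x z)
    (hι : ∀ h x y, ι h * ε x y * (ι h)⁻¹ = ε (h • x) (h • y)) :
    ∃ Ψ : (parabolicAmalgam w g hg).UniversalGroup →* W,
      ∀ (V : ParabolicShape) (k : Fin 4), k ∈ V.1 → ∀ x : parabolic w g V,
        Ψ (parabolicIncl w g hg V x) =
          ε (w 0) (parabolicVertex w g k) * ι x * (ε (w 0) (parabolicVertex w g k))⁻¹ := by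
  have hmul : ∀ (V : ParabolicShape) (k l : Fin 4), k ∈ V.1 → l ∈ V.1 →
      ε (w 0) (parabolicVertex w g l) = ε (w 0) (parabolicVertex w g k) *
        ε (parabolicVertex w g k) (parabolicVertex w g l) := fun V k l hk hl =>
    (hε _ _ _ (S.inc_vertex_zero k) (S.inc_vertex V k l hk hl) (S.inc_vertex_zero l)).symm
  have hcompat : ∀ (V : ParabolicShape) (k l : Fin 4), k ∈ V.1 → l ∈ V.1 →
      ∀ x ∈ parabolic w g V,
      ε (w 0) (parabolicVertex w g k) * ι x * (ε (w 0) (parabolicVertex w g k))⁻¹ =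
        ε (w 0) (parabolicVertex w g l) * ι x * (ε (w 0) (parabolicVertex w g l))⁻¹ := by
    intro V k l hk hl x hx
    have h := hι x (parabolicVertex w g k) (parabolicVertex w g l)
    rw [mem_parabolic.1 hx k hk, mem_parabolic.1 hx l hl, mul_inv_eq_iff_eq_mul] at h
    rw [hmul V k l hk hl, mul_inv_rev, mul_assoc (ε (w 0) _) (ε _ _) (ι x), ← h]
    group
  let π (V : ParabolicShape) : parabolic w g V →* W :=
    (MulAut.conj (ε (w 0) (parabolicVertex w g V.2.1.choose))).toMonoidHom.comp
      (ι.comp (parabolic w g V).subtype)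
  have hπ : ∀ (V : ParabolicShape) (k : Fin 4), k ∈ V.1 → ∀ x : parabolic w g V, π V x =
      ε (w 0) (parabolicVertex w g k) * ι x * (ε (w 0) (parabolicVertex w g k))⁻¹ :=
    fun V k hk x => hcompat V _ k V.2.1.choose_spec hk x x.2
  refine ⟨(parabolicAmalgam w g hg).lift π ?_ ?_, ?_⟩
  · intro V V' h x
    have hk := V'.2.1.choose_spec
    exact (hπ V' _ hk _).trans (hπ V _ (h.le hk) x).symm
  · intro x
    have h1 := hι g (parabolicVertex w g 1) (parabolicVertex w g 2)
    have hg1 : g • parabolicVertex w g 1 = parabolicVertex w g 1 := hg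
    have hg2 : g • parabolicVertex w g 2 = parabolicVertex w g 3 := rfl
    rw [hg1, hg2] at h1
    have h2 := hπ (.vertex 2) 2 (by decide) x
    have h3 := hπ (.vertex 3) 3 (by decide) (parabolicConj w g x)
    have h4 := hπ (.vertex 1) 1 (by decide) ⟨g, mem_parabolic_vertex.2 hg⟩
    change π (.vertex 3) (parabolicConj w g x) = π (.vertex 1) ⟨g, mem_parabolic_vertex.2 hg⟩ *
      π (.vertex 2) x * (π (.vertex 1) ⟨g, mem_parabolic_vertex.2 hg⟩)⁻¹
    have hx : ((parabolicConj w g x : parabolic w g (.vertex 3)) : G) = g * x.1 * g⁻¹ := rfl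
    rw [h2, h3, h4, hmul (.pair 2) 1 2 (by decide) (by decide),
      hmul (.pair 3) 1 3 (by decide) (by decide), ← h1, hx, map_mul, map_mul, map_inv]
    group
  · exact fun V k hk x => ((parabolicAmalgam w g hg).lift_incl _ _ _ x).trans (hπ V k hk x)

/-- If the universal enveloping group is `G`, then an equivariant cocycle `ε` is a coboundary: the
twisted homomorphism `s : G → W` gives the well-defined potential `h vₖ ↦ s(h) ε(w¹, vₖ) ι(h)⁻¹`,
where `vₖ` are the vertices of the amalgam. -/
theorem IsParabolicSystem.exists_potential (S : IsParabolicSystem Γ w g)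
    (hg : g ∈ MulAction.stabilizer G (w 1))
    (hbij : Function.Bijective (parabolicHom w g hg))
    (hε : ∀ x y z, Γ.inc x y → Γ.inc y z → Γ.inc x z → ε x y * ε y z = ε x z)
    (hι : ∀ h x y, ι h * ε x y * (ι h)⁻¹ = ε (h • x) (h • y))
    (ρ : W →* G) (hρι : ∀ h, ρ (ι h) = h) (hρε : ∀ x y, ρ (ε x y) = 1) :
    ∃ P : X → W, (∀ x, ρ (P x) = 1) ∧ ∀ x y, Γ.inc x y → ε x y = (P x)⁻¹ * P y := by
  obtain ⟨Ψ, hΨ⟩ := S.exists_twisted_hom hg hε hι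
  let e : (parabolicAmalgam w g hg).UniversalGroup ≃* G :=
    MulEquiv.ofBijective (parabolicHom w g hg) hbij
  let s : G →* W := Ψ.comp e.symm.toMonoidHom
  have hs : ∀ (k : Fin 4) (x : G), x • parabolicVertex w g k = parabolicVertex w g k →
      s x = ε (w 0) (parabolicVertex w g k) * ι x * (ε (w 0) (parabolicVertex w g k))⁻¹ := by
    intro k x hx
    have hx' := mem_parabolic_vertex.2 hx
    have h₁ : e.symm x = parabolicIncl w g hg (.vertex k) ⟨x, hx'⟩ := by
      rw [MulEquiv.symm_apply_eq]
      exact (parabolicHom_incl w g hg (.vertex k) ⟨x, hx'⟩).symm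
    exact (congrArg Ψ h₁).trans (hΨ (.vertex k) k (Finset.mem_singleton_self k) ⟨x, hx'⟩)
  have hρs : ∀ x, ρ (s x) = x := by
    have h : ρ.comp Ψ = parabolicHom w g hg := by
      refine FusedAmalgam.hom_ext _ fun V x => ?_
      refine Eq.trans ?_ (parabolicHom_incl w g hg V x).symm
      refine (congrArg ρ (hΨ V _ V.2.1.choose_spec x)).trans ?_
      rw [map_mul, map_mul, map_inv, hρε, hρι, one_mul, inv_one, mul_one]
    intro x
    have h' := DFunLike.congr_fun h (e.symm x)
    exact h'.trans (e.apply_symm_apply x)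
  let Q (h : G) (k : Fin 4) : W := s h * ε (w 0) (parabolicVertex w g k) * (ι h)⁻¹
  have hQstab : ∀ (h x : G) (k : Fin 4), x • parabolicVertex w g k = parabolicVertex w g k →
      Q (h * x) k = Q h k := by
    intro h x k hx
    simp only [Q, map_mul, hs k x hx]
    group
  have hg2 : g • parabolicVertex w g 2 = parabolicVertex w g 3 := rfl
  have hQg : ∀ h : G, Q (h * g) 2 = Q h 3 := by
    intro h
    have hg1 : g • parabolicVertex w g 1 = parabolicVertex w g 1 := hg
    have h1 := hι g (parabolicVertex w g 1) (parabolicVertex w g 2)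
    rw [hg1, hg2] at h1
    simp only [Q, map_mul, hs 1 g hg1]
    rw [← hε _ _ _ (S.inc_vertex_zero 1) (S.inc_vertex_one 2) (S.inc_vertex_zero 2),
      ← hε _ _ _ (S.inc_vertex_zero 1) (S.inc_vertex_one 3) (S.inc_vertex_zero 3), ← h1]
    group
  have hQ : ∀ (h h' : G) (k l : Fin 4),
      h • parabolicVertex w g k = h' • parabolicVertex w g l → Q h k = Q h' l := by
    intro h h' k l hkl
    have htype : vertexType k = vertexType l := by
      rw [← S.typ_vertex, ← S.typ_vertex, ← S.typ_smul h, hkl, S.typ_smul]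
    have hQsame : ∀ (h h' : G) (k : Fin 4),
        h • parabolicVertex w g k = h' • parabolicVertex w g k → Q h k = Q h' k := by
      intro h h' k hk
      have := hQstab h' (h'⁻¹ * h) k (by rw [mul_smul, hk, inv_smul_smul])
      rwa [mul_inv_cancel_left] at this
    obtain rfl | ⟨rfl, rfl⟩ | ⟨rfl, rfl⟩ := vertexType_eq_iff.1 htype
    · exact hQsame h h' k hkl
    · rw [← hQg]
      exact hQsame _ _ 2 (by rw [hkl, mul_smul, hg2])
    · rw [← hQg]
      exact hQsame _ _ 2 (by rw [← hkl, mul_smul, hg2])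
  have hex : ∀ y, ∃ (h : G) (k : Fin 4), y = h • parabolicVertex w g k := by
    intro y
    obtain ⟨h, V, hV⟩ := S.exists_smul_vertex {y} (by
      rintro _ rfl _ rfl
      exact Γ.inc_refl _)
    obtain ⟨k, -, hk⟩ := hV y rfl
    exact ⟨h, k, hk⟩
  choose t m htm using hex
  refine ⟨fun y => Q (t y) (m y), fun y => ?_, fun y z hyz => ?_⟩
  · simp [Q, hρs, hρι, hρε]
  · obtain ⟨h, V, hV⟩ := S.exists_smul_vertex {y, z} (by
      rintro _ (rfl | rfl) _ (rfl | rfl)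
      exacts [Γ.inc_refl _, hyz, Γ.inc_symm hyz, Γ.inc_refl _])
    obtain ⟨k, hkV, hk⟩ := hV y (Or.inl rfl)
    obtain ⟨l, hlV, hl⟩ := hV z (Or.inr rfl)
    dsimp only
    rw [hQ (t y) h (m y) k ((htm y).symm.trans hk), hQ (t z) h (m z) l ((htm z).symm.trans hl), hk,
      hl, ← hι]
    have := hε _ _ _ (S.inc_vertex_zero k) (S.inc_vertex V k l hkV hlV) (S.inc_vertex_zero l)
    rw [← eq_inv_mul_iff_mul_eq] at this
    rw [this]
    simp only [Q]
    group

/-- An arbitrary cocycle with values in `A` is made equivariant by passing to the functions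
`G → A`, on which `G` acts by translation. -/
theorem IsParabolicSystem.isSimplyConnected (S : IsParabolicSystem Γ w g)
    (hg : g ∈ MulAction.stabilizer G (w 1)) (hconn : Γ.IsConnected)
    (hbij : Function.Bijective (parabolicHom w g hg)) : Γ.IsSimplyConnected := by
  refine Pregeometry.isSimplyConnected_of_cocycles hconn fun A _ c hc => ?_
  let W := (G → A) ⋊[mulAutArrow (G := G) (A := G) (M := A)] G
  let ε (x y : X) : W := SemidirectProduct.inl fun k : G => c (k⁻¹ • x) (k⁻¹ • y)
  obtain ⟨P, hP, hεP⟩ := S.exists_potential (W := W) (ε := ε) (ι := SemidirectProduct.inr) hg hbij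
    (fun x y z hxy hyz hxz => by
      simp only [ε, ← map_mul]
      congr 1
      ext k
      exact hc _ _ _ ((S.inc_smul_iff _ _ _).2 hxy) ((S.inc_smul_iff _ _ _).2 hyz)
        ((S.inc_smul_iff _ _ _).2 hxz))
    (fun h x y => by
      simp only [ε]
      rw [← map_inv, ← SemidirectProduct.inl_aut]
      congr 1
      ext k
      change c ((h⁻¹ * k)⁻¹ • x) ((h⁻¹ * k)⁻¹ • y) = _
      rw [mul_inv_rev, inv_inv, mul_smul, mul_smul])
    SemidirectProduct.rightHom (fun h => SemidirectProduct.rightHom_inr h)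
    (fun x y => SemidirectProduct.rightHom_inl _)
  refine ⟨fun x => (P x).left 1, fun x y hxy => ?_⟩
  have hPl : ∀ x, P x = SemidirectProduct.inl (P x).left := fun x =>
    SemidirectProduct.ext rfl (hP x)
  have h := hεP x y hxy
  rw [hPl x, hPl y, ← map_inv, ← map_mul] at h
  simpa using congrFun (SemidirectProduct.inl_injective h) 1

end Cocycle

/-! ### The coset geometry of the universal enveloping group -/

section CosetGeometry

variable {G : Type u} {X : Type v} [Group G] [MulAction G X] {w : Fin 3 → X} {g : G}
  (hg : g ∈ MulAction.stabilizer G (w 1))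

theorem parabolicIncl_vertex_of_mem {V : ParabolicShape} {k : Fin 4} (hk : k ∈ V.1) {x : G}
    (hx : x ∈ parabolic w g V) (hxk : x ∈ parabolic w g (.vertex k)) :
    parabolicIncl w g hg (.vertex k) ⟨x, hxk⟩ = parabolicIncl w g hg V ⟨x, hx⟩ := by
  by_cases h : V = .vertex k
  · subst h
    rfl
  · have hle : V ≤ .vertex k := Finset.singleton_subset_iff.2 hk
    exact (parabolicAmalgam w g hg).incl_map (lt_of_le_of_ne hle h) ⟨x, hx⟩

/-- The parabolic subgroups at two compatible vertices are amalgamated along the stabiliser of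
both. -/
theorem parabolicIncl_vertex_eq {V : ParabolicShape} {k l : Fin 4} (hk : k ∈ V.1) (hl : l ∈ V.1)
    {x : G} (hxk : x ∈ parabolic w g (.vertex k)) (hxl : x ∈ parabolic w g (.vertex l)) :
    parabolicIncl w g hg (.vertex k) ⟨x, hxk⟩ = parabolicIncl w g hg (.vertex l) ⟨x, hxl⟩ := by
  let V' : ParabolicShape := ⟨{k, l}, ⟨k, by simp⟩, fun h => V.2.2
    ⟨Finset.insert_subset hk (Finset.singleton_subset_iff.2 hl) h.1,
      Finset.insert_subset hk (Finset.singleton_subset_iff.2 hl) h.2⟩⟩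
  have hx : x ∈ parabolic w g V' := by
    rw [mem_parabolic_vertex] at hxk hxl
    refine mem_parabolic.2 fun m hm => ?_
    obtain rfl | hm := Finset.mem_insert.1 hm
    · exact hxk
    · rwa [Finset.mem_singleton.1 hm]
  rw [parabolicIncl_vertex_of_mem hg (V := V') (by simp [V']) hx hxk,
    parabolicIncl_vertex_of_mem hg (V := V') (by simp [V']) hx hxl]

variable (w g) in
/-- The element `g` of the parabolic subgroup `G_{w²}`, in the universal enveloping group. -/
def fusionElement : (parabolicAmalgam w g hg).UniversalGroup :=
  parabolicIncl w g hg (.vertex 1) ⟨g, mem_parabolic_vertex.2 hg⟩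

theorem parabolicHom_fusionElement : parabolicHom w g hg (fusionElement w g hg) = g :=
  parabolicHom_incl w g hg _ _

theorem parabolicIncl_conj (x : parabolic w g (.vertex 2)) :
    parabolicIncl w g hg (.vertex 3) (parabolicConj w g x) =
      fusionElement w g hg * parabolicIncl w g hg (.vertex 2) x * (fusionElement w g hg)⁻¹ :=
  (parabolicAmalgam w g hg).incl_γ x

variable (w g) in
/-- The elements of type `i` of the coset geometry are the left cosets, in the universal enveloping
group, of the parabolic subgroup at the vertex `wⁱ`. -/
abbrev CosetElement : Type _ :=
  Σ i : Fin 3, (parabolicAmalgam w g hg).UniversalGroup ⧸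
    (parabolicIncl w g hg (.vertex i.castSucc)).range

namespace CosetElement

/-- The trivial coset of type `i`. -/
def trivialCoset (i : Fin 3) : CosetElement w g hg :=
  ⟨i, ((1 : (parabolicAmalgam w g hg).UniversalGroup) : _ ⧸ _)⟩

/-- The vertices of the amalgam, lifted to the coset geometry. -/
def base : Fin 4 → CosetElement w g hg :=
  ![trivialCoset hg 0, trivialCoset hg 1, trivialCoset hg 2,
    fusionElement w g hg • trivialCoset hg 2]

theorem smul_trivialCoset_eq_iff (i : Fin 3) (u : (parabolicAmalgam w g hg).UniversalGroup) :
    u • trivialCoset hg i = trivialCoset hg i ↔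
      u ∈ (parabolicIncl w g hg (.vertex i.castSucc)).range := by
  set H := (parabolicIncl w g hg (.vertex i.castSucc)).range
  have h : u • ((1 : (parabolicAmalgam w g hg).UniversalGroup) :
      (parabolicAmalgam w g hg).UniversalGroup ⧸ H) =
        ((u * 1 : (parabolicAmalgam w g hg).UniversalGroup) : _ ⧸ H) := rfl
  rw [trivialCoset, Sigma.smul_mk, Sigma.mk.injEq]
  simp only [heq_eq_eq, true_and]
  rw [h, eq_comm, QuotientGroup.eq, inv_one, one_mul, mul_one]

/-- The stabiliser of a lifted vertex is the parabolic subgroup at this vertex. -/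
theorem smul_base_eq_iff (k : Fin 4) (u : (parabolicAmalgam w g hg).UniversalGroup) :
    u • base hg k = base hg k ↔ u ∈ (parabolicIncl w g hg (.vertex k)).range := by
  fin_cases k
  · exact smul_trivialCoset_eq_iff hg 0 u
  · exact smul_trivialCoset_eq_iff hg 1 u
  · exact smul_trivialCoset_eq_iff hg 2 u
  · change u • fusionElement w g hg • trivialCoset hg 2 =
      fusionElement w g hg • trivialCoset hg 2 ↔
        u ∈ (parabolicIncl w g hg (.vertex 3)).range
    rw [← inv_smul_eq_iff, smul_smul, smul_smul, smul_trivialCoset_eq_iff]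
    constructor
    · rintro ⟨x, hx⟩
      refine ⟨parabolicConj w g x, ?_⟩
      rw [parabolicIncl_conj]
      change parabolicIncl w g hg (.vertex 2) x = _ at hx
      rw [hx]
      group
    · rintro ⟨y, rfl⟩
      obtain ⟨x, rfl⟩ := (parabolicConj w g).surjective y
      refine ⟨x, ?_⟩
      change parabolicIncl w g hg (.vertex 2) x = _
      rw [parabolicIncl_conj]
      group

theorem fusionElement_smul_base_one : fusionElement w g hg • base hg 1 = base hg 1 :=
  (smul_base_eq_iff hg 1 _).2 ⟨_, rfl⟩

theorem fusionElement_smul_base_two : fusionElement w g hg • base hg 2 = base hg 3 :=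
  rfl

theorem exists_eq_smul_base (a : CosetElement w g hg) : 
    ∃ (u : (parabolicAmalgam w g hg).UniversalGroup) (k : Fin 4), a = u • base hg k := by
  obtain ⟨i, q⟩ := a
  obtain ⟨u, rfl⟩ := QuotientGroup.mk_surjective q
  refine ⟨u, i.castSucc, ?_⟩
  have h : base hg i.castSucc = trivialCoset hg i := by fin_cases i <;> rfl
  rw [h, trivialCoset, Sigma.smul_mk]
  change _ = (⟨i, ((u * 1 : (parabolicAmalgam w g hg).UniversalGroup) : _ ⧸ _)⟩ :
    CosetElement w g hg)
  rw [mul_one]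

/-- The projection of the coset geometry onto `Γ`. -/
def proj (a : CosetElement w g hg) : X :=
  Quotient.liftOn' a.2 (fun u => parabolicHom w g hg u • w a.1) fun u u' huu' => by
    obtain ⟨x, hx⟩ := QuotientGroup.leftRel_apply.1 huu'
    have hx' := congrArg (parabolicHom w g hg) hx
    rw [parabolicHom_incl, map_mul, map_inv] at hx'
    have hfix := mem_parabolic_vertex.1 x.2
    have hw : parabolicVertex w g a.1.castSucc = w a.1 := by
      obtain ⟨i, -⟩ := a
      fin_cases i <;> rfl
    rw [hw, hx', mul_smul, inv_smul_eq_iff] at hfix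
    exact hfix.symm

theorem proj_smul (u : (parabolicAmalgam w g hg).UniversalGroup) (a : CosetElement w g hg) :
    proj hg (u • a) = parabolicHom w g hg u • proj hg a := by
  obtain ⟨i, q⟩ := a
  obtain ⟨u', rfl⟩ := QuotientGroup.mk_surjective q
  change parabolicHom w g hg (u * u') • w i = parabolicHom w g hg u • parabolicHom w g hg u' • w i
  rw [map_mul, mul_smul]

theorem proj_base (k : Fin 4) : proj hg (base hg k) = parabolicVertex w g k := by
  have h : ∀ i, proj hg (trivialCoset hg i) = w i := fun i => by
    change parabolicHom w g hg 1 • w i = w i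
    rw [map_one, one_smul]
  fin_cases k
  · exact h 0
  · exact h 1
  · exact h 2
  · change proj hg (fusionElement w g hg • trivialCoset hg 2) = g • w 2
    rw [proj_smul, h, parabolicHom_fusionElement]

/-- Incidence of distinct elements of the coset geometry: both are obtained from distinct vertices
of a flag of the amalgam by the same translation. -/
def Rel (a b : CosetElement w g hg) : Prop :=
  ∃ (u : (parabolicAmalgam w g hg).UniversalGroup) (V : ParabolicShape) (k l : Fin 4),
    k ∈ V.1 ∧ l ∈ V.1 ∧ k ≠ l ∧ a = u • base hg k ∧ b = u • base hg l

theorem Rel.symm {a b : CosetElement w g hg} : Rel hg a b → Rel hg b a :=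
  fun ⟨u, V, k, l, hk, hl, hkl, ha, hb⟩ => ⟨u, V, l, k, hl, hk, hkl.symm, hb, ha⟩

theorem Rel.smul {a b : CosetElement w g hg} (u : (parabolicAmalgam w g hg).UniversalGroup) :
    Rel hg a b → Rel hg (u • a) (u • b) := by
  rintro ⟨u', V, k, l, hk, hl, hkl, rfl, rfl⟩
  exact ⟨u * u', V, k, l, hk, hl, hkl, smul_smul _ _ _, smul_smul _ _ _⟩

/-- In the definition of incidence, the pair of `w²` and `g w³` is superfluous, as it is the
translate by `g` of the pair of `w²` and `w³`. -/
theorem Rel.exists_reduced {a b : CosetElement w g hg} (h : Rel hg a b) :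
    ∃ (u : (parabolicAmalgam w g hg).UniversalGroup) (V : ParabolicShape) (k l : Fin 4),
      k ∈ V.1 ∧ l ∈ V.1 ∧ (k = 0 ∨ l = 0 ∨ (k = 1 ∧ l = 2) ∨ (k = 2 ∧ l = 1)) ∧
      a = u • base hg k ∧ b = u • base hg l := by
  obtain ⟨u, V, k, l, hk, hl, hkl, rfl, rfl⟩ := h
  by_cases h₁ : k = 1 ∧ l = 3
  · obtain ⟨rfl, rfl⟩ := h₁
    refine ⟨u * fusionElement w g hg, .pair 2, 1, 2, by decide, by decide, by decide, ?_, ?_⟩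
    · rw [mul_smul, fusionElement_smul_base_one]
    · rw [mul_smul, fusionElement_smul_base_two]
  by_cases h₂ : k = 3 ∧ l = 1
  · obtain ⟨rfl, rfl⟩ := h₂
    refine ⟨u * fusionElement w g hg, .pair 2, 2, 1, by decide, by decide, by decide, ?_, ?_⟩
    · rw [mul_smul, fusionElement_smul_base_two]
    · rw [mul_smul, fusionElement_smul_base_one]
  have h : ∀ (V : ParabolicShape) (k l : Fin 4), k ∈ V.1 → l ∈ V.1 → k ≠ l → ¬ (k = 1 ∧ l = 3) →
      ¬ (k = 3 ∧ l = 1) → (k = 0 ∨ l = 0 ∨ (k = 1 ∧ l = 2) ∨ (k = 2 ∧ l = 1)) := by decide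
  exact ⟨u, V, k, l, hk, hl, h V k l hk hl hkl h₁ h₂, rfl, rfl⟩

variable {hg}

theorem exists_smul_base_eq {k l : Fin 4} (hkl : vertexType k = vertexType l) :
    ∃ u : (parabolicAmalgam w g hg).UniversalGroup, u • base hg k = base hg l := by
  obtain rfl | ⟨rfl, rfl⟩ | ⟨rfl, rfl⟩ := vertexType_eq_iff.1 hkl
  · exact ⟨1, one_smul _ _⟩
  · exact ⟨fusionElement w g hg, fusionElement_smul_base_two hg⟩
  · exact ⟨(fusionElement w g hg)⁻¹, inv_smul_eq_iff.2 (fusionElement_smul_base_two hg).symm⟩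

end CosetElement

namespace IsParabolicSystem

open CosetElement

variable {hg} {Γ : Pregeometry X (Fin 3)}

/-- A translation in `Γ` from a vertex of the amalgam to the projection of `a` lifts to one that
ends at `a`. -/
theorem exists_smul_base_of_proj_eq (S : IsParabolicSystem Γ w g)
    {a : CosetElement w g hg} {h : G} {k : Fin 4}
    (ha : proj hg a = h • parabolicVertex w g k) :
    ∃ u, parabolicHom w g hg u = h ∧ a = u • base hg k := by
  obtain ⟨u, l, rfl⟩ := exists_eq_smul_base hg a
  rw [proj_smul, proj_base] at ha
  have htype : vertexType k = vertexType l := by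
    rw [← S.typ_vertex, ← S.typ_vertex, ← S.typ_smul h, ← ha, S.typ_smul]
  obtain ⟨u', hu'⟩ := exists_smul_base_eq (hg := hg) htype
  have hu'' := congrArg (proj hg) hu'
  rw [proj_smul, proj_base, proj_base] at hu''
  rw [← hu''] at ha
  have hx : (parabolicHom w g hg (u * u'))⁻¹ * h ∈ parabolic w g (.vertex k) := by
    rw [mem_parabolic_vertex, mul_smul, ← ha, map_mul, mul_inv_rev, mul_smul, inv_smul_smul,
      inv_smul_smul]
  refine ⟨u * u' * parabolicIncl w g hg (.vertex k) ⟨_, hx⟩, ?_, ?_⟩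
  · rw [map_mul, parabolicHom_incl, mul_inv_cancel_left]
  · rw [mul_smul, (smul_base_eq_iff hg k _).2 ⟨_, rfl⟩, mul_smul, hu']

/-- Edges lift uniquely. After a translation both lifted edges start at a vertex of the amalgam, and
the element that compares them stabilises both ends in `Γ`, so it lies in a member of the amalgam;
the separation of the orbits of `w³` and `g w³` excludes the mixed case. -/
theorem unique_lift (S : IsParabolicSystem Γ w g) {a b b' : CosetElement w g hg}
    (h : Rel hg a b) (h' : Rel hg a b') (hbb' : proj hg b = proj hg b') : b = b' := by
  obtain ⟨u, V, k, l, hk, hl, hkl, rfl, rfl⟩ := h.exists_reduced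
  obtain ⟨u', V', k', l', -, -, hkl', ha, rfl⟩ := h'.exists_reduced
  have hpa := congrArg (proj hg) ha
  simp only [proj_smul, proj_base] at hbb' hpa
  have htk : vertexType k = vertexType k' := by
    rw [← S.typ_vertex, ← S.typ_vertex, ← S.typ_smul _ (parabolicVertex w g k), hpa, S.typ_smul]
  have htl : vertexType l = vertexType l' := by
    rw [← S.typ_vertex, ← S.typ_vertex, ← S.typ_smul _ (parabolicVertex w g l), hbb', S.typ_smul]
  set s := u⁻¹ * u' with hs
  have hsk : s • base hg k' = base hg k := by rw [hs, mul_smul, ← ha, inv_smul_smul]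
  have hpk : parabolicHom w g hg s • parabolicVertex w g k' = parabolicVertex w g k := by
    rw [hs, map_mul, map_inv, mul_smul, ← hpa, inv_smul_smul]
  have hpl : parabolicHom w g hg s • parabolicVertex w g l' = parabolicVertex w g l := by
    rw [hs, map_mul, map_inv, mul_smul, ← hbb', inv_smul_smul]
  suffices s • base hg l' = base hg l by
    rw [← this, hs, mul_smul, smul_inv_smul]
  -- An element of `G_{w¹}` does not interchange the orbits of `w³` and `g w³`.
  have hsep : ∀ x : G, x • parabolicVertex w g 0 = parabolicVertex w g 0 →
      x • parabolicVertex w g 2 ≠ parabolicVertex w g 3 := S.separated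
  have hsep' : ∀ x : G, x • parabolicVertex w g 0 = parabolicVertex w g 0 →
      x • parabolicVertex w g 3 ≠ parabolicVertex w g 2 := fun x h0 h3 =>
    hsep x⁻¹ (inv_smul_eq_iff.2 h0.symm) (inv_smul_eq_iff.2 h3.symm)
  have hcases : ∀ k l k' l' : Fin 4, (k = 0 ∨ l = 0 ∨ (k = 1 ∧ l = 2) ∨ (k = 2 ∧ l = 1)) →
      (k' = 0 ∨ l' = 0 ∨ (k' = 1 ∧ l' = 2) ∨ (k' = 2 ∧ l' = 1)) →
      vertexType k = vertexType k' → vertexType l = vertexType l' → (k' = k ∧ l' = l) ∨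
        ((k' = 0 ∧ k = 0) ∧ ((l' = 2 ∧ l = 3) ∨ (l' = 3 ∧ l = 2))) ∨
        ((l' = 0 ∧ l = 0) ∧ ((k' = 2 ∧ k = 3) ∨ (k' = 3 ∧ k = 2))) := by decide
  obtain ⟨rfl, rfl⟩ | ⟨⟨rfl, rfl⟩, ⟨rfl, rfl⟩ | ⟨rfl, rfl⟩⟩ | ⟨⟨rfl, rfl⟩, ⟨rfl, rfl⟩ | ⟨rfl, rfl⟩⟩ :=
    hcases k l k' l' hkl hkl' htk htl
  · obtain ⟨x, hx⟩ := (smul_base_eq_iff hg k' s).1 hsk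
    rw [← hx, parabolicHom_incl] at hpl
    rw [smul_base_eq_iff, ← hx]
    exact ⟨⟨x, mem_parabolic_vertex.2 hpl⟩, (parabolicIncl_vertex_eq hg hk hl _ _).symm⟩
  · exact absurd hpl (hsep _ hpk)
  · exact absurd hpl (hsep' _ hpk)
  · exact absurd hpk (hsep _ hpl)
  · exact absurd hpk (hsep' _ hpl)

theorem adj_of_rel (S : IsParabolicSystem Γ w g) {a b : CosetElement w g hg} (h : Rel hg a b) :
    Γ.incidenceGraph.Adj (proj hg a) (proj hg b) := by
  obtain ⟨u, V, k, l, hk, hl, hkl, rfl, rfl⟩ := h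
  rw [proj_smul, proj_smul, proj_base, proj_base]
  refine ⟨fun h => ?_, (S.inc_smul_iff _ _ _).2 (S.inc_vertex V k l hk hl)⟩
  have hV : ∀ (V : ParabolicShape) (k l : Fin 4), k ∈ V.1 → l ∈ V.1 → k ≠ l →
      vertexType k ≠ vertexType l := by decide
  refine hV V k l hk hl hkl ?_
  rw [← S.typ_vertex, ← S.typ_vertex, MulAction.injective _ h]

/-- The coset geometry covers `Γ`. -/
theorem isCovering (S : IsParabolicSystem Γ w g) : Γ.IsCovering (proj hg) (Rel hg) where
  symm := Rel.symm hg
  adj := S.adj_of_rel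
  exists_lift := by
    intro a y hay
    obtain ⟨h, V, hV⟩ := S.exists_smul_vertex {proj hg a, y} (by
      rintro _ (rfl | rfl) _ (rfl | rfl)
      exacts [Γ.inc_refl _, hay.2, Γ.inc_symm hay.2, Γ.inc_refl _])
    obtain ⟨k, hk, hak⟩ := hV _ (Or.inl rfl)
    obtain ⟨l, hl, hyl⟩ := hV _ (Or.inr rfl)
    obtain ⟨u, rfl, ha⟩ := S.exists_smul_base_of_proj_eq hak
    refine ⟨u • base hg l, ⟨u, V, k, l, hk, hl, ?_, ha, rfl⟩, ?_⟩
    · rintro rfl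
      exact hay.1 (hak.trans hyl.symm)
    · rw [proj_smul, proj_base, hyl]
  unique := S.unique_lift
  triangle := by
    intro a b c hab hbc hac
    have hab' := S.adj_of_rel hab
    have hbc' := S.adj_of_rel hbc
    obtain ⟨h, V, hV⟩ := S.exists_smul_vertex {proj hg a, proj hg b, proj hg c} (by
      rintro _ (rfl | rfl | rfl) _ (rfl | rfl | rfl)
      exacts [Γ.inc_refl _, hab'.2, hac.2, Γ.inc_symm hab'.2, Γ.inc_refl _, hbc'.2,
        Γ.inc_symm hac.2, Γ.inc_symm hbc'.2, Γ.inc_refl _])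
    obtain ⟨k, hk, hak⟩ := hV _ (Or.inl rfl)
    obtain ⟨l, hl, hbl⟩ := hV _ (Or.inr (Or.inl rfl))
    obtain ⟨m, hm, hcm⟩ := hV _ (Or.inr (Or.inr rfl))
    -- Lift the flag from its middle element `b`; by uniqueness of lifts of edges, the other two
    -- elements of the lifted flag are `a` and `c`.
    obtain ⟨u, rfl, hb⟩ := S.exists_smul_base_of_proj_eq hbl
    have ha : a = u • base hg k := by
      refine S.unique_lift (Rel.symm hg hab) ⟨u, V, l, k, hl, hk, ?_, hb, rfl⟩ ?_
      · rintro rfl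
        exact hab'.1 (hak.trans hbl.symm)
      · rw [proj_smul, proj_base, hak]
    have hc : c = u • base hg m := by
      refine S.unique_lift hbc ⟨u, V, l, m, hl, hm, ?_, hb, rfl⟩ ?_
      · rintro rfl
        exact hbc'.1 (hbl.trans hcm.symm)
      · rw [proj_smul, proj_base, hcm]
    refine ⟨u, V, k, m, hk, hm, ?_, ha, hc⟩
    rintro rfl
    exact hac.1 (hak.trans hcm.symm)

variable (hg)

/-- The coset geometry is connected, because the universal enveloping group is generated by the
parabolic subgroups. -/
theorem reflTransGen_smul_base (u : (parabolicAmalgam w g hg).UniversalGroup) :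
    Relation.ReflTransGen (Rel hg) (base hg 0) (u • base hg 0) := by
  have hsmul : ∀ (u : (parabolicAmalgam w g hg).UniversalGroup) {a b : CosetElement w g hg},
      Relation.ReflTransGen (Rel hg) a b → Relation.ReflTransGen (Rel hg) (u • a) (u • b) :=
    fun u a b h => h.lift (u • ·) fun _ _ => Rel.smul hg u
  have hsymm : ∀ {a b : CosetElement w g hg},
      Relation.ReflTransGen (Rel hg) a b → Relation.ReflTransGen (Rel hg) b a := by
    intro a b h
    induction h with
    | refl => exact .refl
    | tail _ h ih => exact ih.head (Rel.symm hg h)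
  let H : Subgroup (parabolicAmalgam w g hg).UniversalGroup :=
    { carrier := {u | Relation.ReflTransGen (Rel hg) (base hg 0) (u • base hg 0)}
      one_mem' := by
        change Relation.ReflTransGen (Rel hg) (base hg 0)
          ((1 : (parabolicAmalgam w g hg).UniversalGroup) • base hg 0)
        rw [one_smul]
      mul_mem' := fun {u v} hu hv => by
        change Relation.ReflTransGen (Rel hg) (base hg 0) ((u * v) • base hg 0)
        rw [mul_smul]
        exact hu.trans (hsmul u hv)
      inv_mem' := fun {u} hu => by
        have := hsmul u⁻¹ (hsymm hu)
        rwa [inv_smul_smul] at this }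
  refine FusedAmalgam.mem_of_incl_mem _ H (fun V x => ?_) u
  -- A parabolic subgroup fixes some lifted vertex `base k`, which is `base 0` or adjacent to it.
  obtain ⟨k, hk⟩ := V.2.1
  have hx : x.1 ∈ parabolic w g (.vertex k) :=
    mem_parabolic_vertex.2 (mem_parabolic.1 x.2 k hk)
  have hk0 : Relation.ReflTransGen (Rel hg) (base hg 0) (base hg k) := by
    by_cases h0 : 0 = k
    · rw [h0]
    · have hV : ∀ k : Fin 4, ∃ V : ParabolicShape, 0 ∈ V.1 ∧ k ∈ V.1 := by decide
      obtain ⟨V', h0', hk'⟩ := hV k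
      exact .single ⟨1, V', 0, k, h0', hk', h0, (one_smul _ _).symm, (one_smul _ _).symm⟩
  have hfix : parabolicIncl w g hg V x • base hg k = base hg k := by
    rw [smul_base_eq_iff]
    exact ⟨⟨x.1, hx⟩, parabolicIncl_vertex_of_mem hg hk x.2 hx⟩
  have h := hsmul (parabolicIncl w g hg V x) (hsymm hk0)
  rw [hfix] at h
  exact hk0.trans h

/-- An element of the kernel fixes the lifted vertex `w¹`, so it lies in the parabolic subgroup
there, which `G` contains faithfully. -/
theorem injective_of_isSimplyConnected (S : IsParabolicSystem Γ w g)
    (hΓ : Γ.IsSimplyConnected) : Function.Injective (parabolicHom w g hg) := by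
  refine (injective_iff_map_eq_one _).2 fun u hu => ?_
  have h : base hg 0 = u • base hg 0 :=
    S.isCovering.eq_of_proj_eq hΓ (reflTransGen_smul_base hg u) (by
      rw [proj_smul, hu, one_smul])
  obtain ⟨x, rfl⟩ := (smul_base_eq_iff hg 0 u).1 h.symm
  rw [parabolicHom_incl] at hu
  rw [OneMemClass.coe_eq_one.1 hu, map_one]

end IsParabolicSystem

end CosetGeometry

/-! ### Simple connectedness and the universal enveloping group -/

theorem mainTheorem5 {X : Type*} (Γ : Pregeometry X (Fin 3))
    (hgeom : Γ.IsGeometry) (hconn : Γ.IsConnected) (hsum : Γ.HasDirectSumProperty)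
    (hdiag : Γ.basicDiagram = SimpleGraph.pathGraph 3)
    (G : Subgroup (Equiv.Perm X)) (hG : G ≤ Γ.autGroup)
    (hvert : Γ.IsVertexTransitive G)
    (hflag : ∀ i j, Γ.basicDiagram.Adj i j → Γ.IsTransitiveOnFlags G {i, j})
    (w : Fin 3 → X) (hw : ∀ i, Γ.typ (w i) = i) (hF : Γ.IsFlag (Set.range w))
    (g : G) (hg : g ∈ MulAction.stabilizer G (w 1))
    (horb : IsOrbitRepresentatives
      (MulAction.stabilizer G (w 0) ⊓ MulAction.stabilizer G (w 1))
      {y | Γ.typ y = 2 ∧ Γ.inc y (w 0) ∧ Γ.inc y (w 1)} {w 2, g • w 2})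
    (hsep : g • w 2 ∉ MulAction.orbit (MulAction.stabilizer G (w 0)) (w 2)) :
    Function.Surjective (parabolicHom w g hg) ∧
      (Γ.IsSimplyConnected ↔ Function.Bijective (parabolicHom w g hg)) := by
  have hadj : Γ.basicDiagram.Adj 0 1 := by
    rw [hdiag, SimpleGraph.pathGraph_adj]
    exact Or.inl rfl
  have S := isParabolicSystem_of_isTransitiveOnFlags hgeom hG (hflag 0 1 hadj) hw hF horb hsep
  have hsurj := parabolicHom_surjective_of_isConnected hg S hconn
  exact ⟨hsurj, fun h => ⟨S.injective_of_isSimplyConnected hg h, hsurj⟩,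
    S.isSimplyConnected hg hconn⟩
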